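/- **Setting.** Let $G$ be a finite connected multigraph embedded in the sphere and $G^*=(V^*,E^*)$ its dual, with a fixed outer face; the faces of $G^*$ are the vertices of $G$. Let $\mathcal T$ be a finite rooted tree in which partition nodes and cluster nodes alternate. Each cluster node $c$ carries a nonempty $K(c)\subseteq V^*$. Each partition node $p$ carries a partition $\pi(p)$, whose parts are the sets $K(c)$ of its children $c$ (different children give disjoint sets); if $p$ has parent $c$, then $\pi(p)$ is a partition of $K(c)$. The root $\hat p$ is a partition node with $\pi(\hat p)=\{V^*\}$, and leaves are cluster nodes with $|K(c)|=1$. Let $Z\in\mathbb N$, and let some (possibly no) partition nodes be designated as shattering. For a family $\pi$ of disjoint subsets of $V^*$, let $\partial(\pi)$ be the set of faces of $G^*$ whose vertices are all covered by $\pi$ but lie in more than one part. For a partition node $p$, let $\mathrm{path}(p)$ be the set of partition nodes on the path from $\hat p$ to $p$, inclusive. Let $\pi^+(p)$ consist of the parts of $\pi(p)$ and of all parts $Q$ of $\pi(p')$, $p'\in \mathrm{path}(p)$, with $Q\not\supseteq K(c)$, where $c$ is the parent of $p$ (and $\pi^+(\hat p)=\pi(\hat p)$). Put $\partial(p)=\partial(\pi(p))$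 and $\partial^+(p)=\partial(\pi^+(p))$. A simple cycle of $G^*$ is amenable for $p$ if the number of its edges joining different parts of $\pi(p)$ is at most $Z$, or $0$ if $p$ is shattering. Let $\mathcal A^+(p)$ be the collection of all $\mathrm{inside}(C)\cap\partial^+(p)$, where $C$ is a simple cycle of $G^*$ amenable for all $p'\in\mathrm{path}(p)$ and $\mathrm{inside}(C)$ is the set of faces of $G^*$ inside $C$. For $p\ne p'$ let $\mathcal A^+(\{p,p'\})=\{S\cup S' : S\in\mathcal A^+(p),\,S'\in\mathcal A^+(p')\}$, and $\mathcal A^+(\{p\})=\mathcal A^+(p)$. Let $\mathcal S(p,s)$ be the set of all $a$ that equal $p$ or are partition nodes below $p$ and satisfy $s\in\partial(a)$. Let $\mathcal S(p,\{s,t\})$ be the set of all $\{a,b\}$ (possibly $a=b$) with $s\in\partial(a)$, $t\in\partial(b)$ and $\mathrm{lca}(a,b)=p$. **Linear program.** For $\alpha\in\mathbb R$, a feasible solution consists of reals $x(\{p\},S)\in[0,1]$ for partition nodes $p$ and $S\in\mathcal A^+(p)$; $x(\{p,p'\},S)\in[0,1]$ for $p\neq p'$ whose lowest common ancestor is a partition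 node and $S\in\mathcal A^+(\{p,p'\})$; and $z(p,s,A,W)$, $y(p,\{s,t\},A,W)$, $y(\{s,t\})$. For all partition nodes $p$, all faces $s\ne t$ of $G^*$ and all $W\in\mathcal A^+(p)$ they satisfy: 1. $x(\{\hat p\},\emptyset)=1$ (in particular $\emptyset\in\mathcal A^+(\hat p)$); 2. $x(\{p\},W)=\sum_{p_i}\sum_{S\in\mathcal A^+(p_i),\,S\cap\partial^+(p)=W}x(\{p_i\},S)$ for every non-leaf child $c$ of $p$, where $p_i$ runs over the children of $c$; 3. $z(p,s,A,W)=\sum x(\{a\},S)$ for $A\subseteq\{s\}$, over $a\in\mathcal S(p,s)$ and $S\in\mathcal A^+(a)$ with $S\cap\{s\}=A$, $S\cap\partial^+(p)=W$; 4. $y(p,\{s,t\},A,W)=\sum x(N,S)$ for $A\subseteq\{s,t\}$, over $N\in\mathcal S(p,\{s,t\})$ and $S\in\mathcal A^+(N)$ with $S\cap\{s,t\}=A$, $S\cap\partial^+(p)=W$; 5. if $\mathcal S(p,\{s,t\})\ne\emptyset$: $z(p,s,A,W)=\sum_{A'\subseteq\{s,t\},\,A'\cap\{s\}=A}y(p,\{s,t\},A',W)$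 for $A\subseteq\{s\}$; 6. if $\mathcal S(p,\{s,t\})\ne\emptyset$: $x(\{p\},W)=\sum x(N,S)$, over $N\in\mathcal S(p,\{s,t\})$ and $S\in\mathcal A^+(N)$ with $S\cap\partial^+(p)=W$; 7. $y(\{s,t\})=\sum_{p}\sum_{A\subseteq\{s,t\},\,|A|=1}\sum_{W\in\mathcal A^+(p)}y(p,\{s,t\},A,W)$, and $\sum_{\{s,t\}}y(\{s,t\})\ge\alpha$. **Rounding.** Start at $\hat p$ with the set $\emptyset$ and go down the tree. Whenever a set $W$ has been chosen at a partition node $p$, do the following for each non-leaf child $c$ of $p$, independently given what was chosen above. Assign to $c$ one of its children $p_i$, with probability $\frac{m_i}{x(\{p\},W)}$, where $m_i=\sum_{S\in\mathcal A^+(p_i),\,S\cap\partial^+(p)=W}x(\{p_i\},S)$; then choose at $p_i$ a set $S\in\mathcal A^+(p_i)$ with $S\cap\partial^+(p)=W$, with probability $x(\{p_i\},S)/m_i$. Let $U$ be the union of all chosen sets. **Statement.** For every feasible solution, the rounding is a well-defined probability distribution on its outcomes, and: * for all $s\neq t$ joined by an edge of $G$ (i.e. faces of $G^*$ sharing a dual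 edge), each of which, as a face of $G^*$, has at least two distinct vertices, $\Pr[|U\cap\{s,t\}|=1]=y(\{s,t\})$; * for every set $\mathcal D$ of demand pairs (pairs of distinct faces of $G^*$) and every $\{s,t\}\in\mathcal D$, $\Pr[|U\cap\{s,t\}|=1]\ge\frac12\,y(\{s,t\})$. -/

import Mathlib

open scoped Classical

noncomputable section

namespace PlanarCut

/-- A connected graph `G` embedded in the sphere, given as a combinatorial map on a set `D` of darts
(oriented edges): `rot` sends a dart to the next one around its origin, `rev` reverses a dart, and
`rot * rev` runs along the faces of `G`. Euler's formula says that the surface is the sphere.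
The vertices of `G` are the orbits of `rot`, its edges those of `rev`, its faces those of
`rot * rev`. -/
structure PlanarMap (D : Type*) where
  rot : Equiv.Perm D
  rev : Equiv.Perm D
  rev_rev : ∀ d, rev (rev d) = d
  rev_ne : ∀ d, rev d ≠ d
  connected : ∀ d e : D, ∃ g ∈ Subgroup.closure {rot, rev}, g d = e
  euler : Nat.card (Quotient (Equiv.Perm.SameCycle.setoid rot))
      + Nat.card (Quotient (Equiv.Perm.SameCycle.setoid (rot * rev)))
    = Nat.card (Quotient (Equiv.Perm.SameCycle.setoid rev)) + 2

namespace PlanarMap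

variable {D : Type*} (M : PlanarMap D)

/-- Faces of the dual `G*`, i.e. vertices of `G`. -/
def DualFace : Type _ := Quotient (Equiv.Perm.SameCycle.setoid M.rot)

/-- Vertices of the dual `G*`, i.e. faces of `G`. -/
def DualVertex : Type _ := Quotient (Equiv.Perm.SameCycle.setoid (M.rot * M.rev))

/-- Edges of the dual `G*`, i.e. edges of `G`. -/
def DualEdge : Type _ := Quotient (Equiv.Perm.SameCycle.setoid M.rev)

instance [Finite D] : Finite M.DualFace :=
  inferInstanceAs (Finite (Quotient (Equiv.Perm.SameCycle.setoid M.rot)))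

instance [Finite D] : Fintype M.DualFace := Fintype.ofFinite _

/-- The dual face (vertex of `G`) that is the origin of the dart `d`. -/
def face (d : D) : M.DualFace := Quotient.mk (Equiv.Perm.SameCycle.setoid M.rot) d

/-- The dual vertex (face of `G`) at the dart `d`. The dual edge of `d` joins `M.vert d` and
`M.vert (M.rev d)`, and lies between the dual faces `M.face d` and `M.face (M.rev d)`. -/
def vert (d : D) : M.DualVertex :=
  Quotient.mk (Equiv.Perm.SameCycle.setoid (M.rot * M.rev)) d

/-- The (dual) edge that carries the dart `d`. -/
def edge (d : D) : M.DualEdge := Quotient.mk (Equiv.Perm.SameCycle.setoid M.rev) d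

/-- The vertices of `G*` on the boundary of the dual face `s`. -/
def faceVerts (s : M.DualFace) : Set M.DualVertex := {v | ∃ d, M.face d = s ∧ M.vert d = v}

/-- `s` and `t` share a dual edge, i.e. are joined by an edge of `G`. -/
def Adjacent (s t : M.DualFace) : Prop := ∃ d, M.face d = s ∧ M.face (M.rev d) = t

/-- `E` is the edge set of a simple cycle of `G*`. Indices in `Fin (k + 1)` are cyclic.
As `G*` is a multigraph, loops and pairs of parallel edges count as cycles. -/
def IsSimpleCycle (E : Finset M.DualEdge) : Prop :=
  ∃ (k : ℕ) (d : Fin (k + 1) → D),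
    (∀ i, M.vert (M.rev (d i)) = M.vert (d (i + 1))) ∧
    Function.Injective (fun i => M.vert (d i)) ∧
    Function.Injective (fun i => M.edge (d i)) ∧
    E = Finset.univ.image (fun i => M.edge (d i))

/-- The dual faces inside the cycle `E` when `outer` is the outer face of `G*`: those that cannot
be reached from `outer` without crossing an edge of `E`. -/
def inside [Finite D] (outer : M.DualFace) (E : Finset M.DualEdge) : Finset M.DualFace :=
  Finset.univ.filter fun s => ¬ Relation.ReflTransGen
    (fun a b => ∃ d, M.face d = a ∧ M.face (M.rev d) = b ∧ M.edge d ∉ E) outer s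

/-- The boundary of a family `Q` of disjoint vertex sets: the dual faces all of whose vertices
are covered by `Q`, but which have vertices in more than one member of `Q`. -/
def boundary [Finite D] (Q : Set (Set M.DualVertex)) : Finset M.DualFace :=
  Finset.univ.filter fun s => M.faceVerts s ⊆ ⋃₀ Q ∧
    ∃ A ∈ Q, ∃ B ∈ Q, A ≠ B ∧ (M.faceVerts s ∩ A).Nonempty ∧ (M.faceVerts s ∩ B).Nonempty

/-- The number of edges of `E` that join different members of `Q`. -/
def crossings (E : Finset M.DualEdge) (Q : Set (Set M.DualVertex)) : ℕ :=
  (E.filter fun e => ∃ d, M.edge d = e ∧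
    ∃ A ∈ Q, ∃ B ∈ Q, A ≠ B ∧ M.vert d ∈ A ∧ M.vert (M.rev d) ∈ B).card

end PlanarMap

/-- The parent map on the nodes (cluster nodes `C`, partition nodes `P`) of an alternating tree. -/
def parentOf {C P : Type*} (clusterParent : C → P) (partParent : P → Option C) :
    C ⊕ P → Option (C ⊕ P)
  | Sum.inl c => some (Sum.inr (clusterParent c))
  | Sum.inr p => (partParent p).map Sum.inl

/-- A nondeterministic hierarchical clustering of a set `V`: a rooted tree in which cluster nodes
and partition nodes alternate. The children of a cluster node `c` are alternative partitions of
`K c`; the children of a partition node are the parts of its partition. The root is a partition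
node that stands for the trivial partition `{V}`, and the leaves are singleton clusters. -/
structure Clustering (V C P : Type*) where
  root : P
  clusterParent : C → P
  partParent : P → Option C
  K : C → Set V
  partParent_eq_none : ∀ p, partParent p = none ↔ p = root
  reachable : ∀ a : C ⊕ P, Relation.ReflTransGen
    (fun u v => parentOf clusterParent partParent v = some u) (Sum.inr root) a
  root_child : ∃ c, (∀ c', clusterParent c' = root ↔ c' = c) ∧ K c = Set.univ
  nonempty : ∀ c, (K c).Nonempty
  disjoint : ∀ c c', clusterParent c = clusterParent c' → c ≠ c' → Disjoint (K c) (K c')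
  cover : ∀ p c, partParent p = some c → (⋃ c' ∈ {c' | clusterParent c' = p}, K c') = K c
  leaf : ∀ c, (∀ p, partParent p ≠ some c) → ∃ v, K c = {v}

namespace Clustering

variable {V C P : Type*} (T : Clustering V C P)

/-- `a` is an ancestor of `b` in the tree, or `a = b`. -/
def IsAncestor (a b : C ⊕ P) : Prop :=
  Relation.ReflTransGen (fun u v => parentOf T.clusterParent T.partParent v = some u) a b

/-- The node `m` is the lowest common ancestor of the nodes `a` and `b`. -/
def IsLCA (m a b : C ⊕ P) : Prop :=
  T.IsAncestor m a ∧ T.IsAncestor m b ∧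
    ∀ m', T.IsAncestor m' a → T.IsAncestor m' b → T.IsAncestor m' m

/-- The partition nodes on the path from the root to the partition node `p`, inclusive. -/
def partnPath (p : P) : Set P := {q | T.IsAncestor (Sum.inr q) (Sum.inr p)}

/-- The parts of the partition `π(p)`. -/
def parts (p : P) : Set (Set V) := {A | ∃ c, T.clusterParent c = p ∧ T.K c = A}

/-- The parts of the partition `π⁺(p)` of `V`. -/
def partsPlus (p : P) : Set (Set V) :=
  T.parts p ∪ {A | (∃ q ∈ T.partnPath p, A ∈ T.parts q) ∧
    ∀ c, T.partParent p = some c → ¬ T.K c ⊆ A}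

end Clustering

/-- The data on which the linear program is built: an embedded graph with an outer face of the dual,
a clustering of the vertices of the dual, the bound `Z` on the number of crossings, and the
(possibly empty) set of shattering partition nodes, which must not be crossed at all. -/
structure Setting (D C P : Type*) where
  map : PlanarMap D
  outer : map.DualFace
  tree : Clustering map.DualVertex C P
  Z : ℕ
  shattering : Set P

namespace Setting

variable {D C P : Type*} [Finite D] [Fintype C] [Fintype P] (I : Setting D C P)

/-- `∂(p)` -/
def bd (p : P) : Finset I.map.DualFace := I.map.boundary (I.tree.parts p)

/-- `∂⁺(p)` -/
def bdPlus (p : P) : Finset I.map.DualFace := I.map.boundary (I.tree.partsPlus p)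

/-- The cycle `E` is amenable for the partition node `q`. -/
def Amenable (E : Finset I.map.DualEdge) (q : P) : Prop :=
  I.map.crossings E (I.tree.parts q) ≤ if q ∈ I.shattering then 0 else I.Z

/-- `𝒜⁺(p)` -/
def APlus (p : P) : Finset (Finset I.map.DualFace) :=
  Finset.univ.filter fun S => ∃ E, I.map.IsSimpleCycle E ∧
    (∀ q ∈ I.tree.partnPath p, I.Amenable E q) ∧ S = I.map.inside I.outer E ∩ I.bdPlus p

/-- `𝒜⁺(N)` for a set `N` of partition nodes: all unions of one member of `𝒜⁺(p)` for each
`p ∈ N`. For `N = {p}` this is `𝒜⁺(p)`, for `N = {p, p'}` it is the collection of all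
`S_p ∪ S_p'`. -/
def APlusSet (N : Finset P) : Finset (Finset I.map.DualFace) :=
  Finset.univ.filter fun S => ∃ f : P → Finset I.map.DualFace, (∀ p ∈ N, f p ∈ I.APlus p) ∧ S = N.biUnion f

/-- `𝒮(p, s)`: the descendants `a` of `p` (`p` included) with `s ∈ ∂(a)`. -/
def nodesOf (p : P) (s : I.map.DualFace) : Finset P :=
  Finset.univ.filter fun a => I.tree.IsAncestor (Sum.inr p) (Sum.inr a) ∧ s ∈ I.bd a

/-- `𝒮(p, {s, t})`: the sets `{a, b}` with `s ∈ ∂(a)`, `t ∈ ∂(b)` and `lca(a, b) = p`. -/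
def pairsOf (p : P) (s t : I.map.DualFace) : Finset (Finset P) :=
  Finset.univ.filter fun N => ∃ a b : P, N = {a, b} ∧ s ∈ I.bd a ∧ t ∈ I.bd b ∧
    I.tree.IsLCA (Sum.inr p) (Sum.inr a) (Sum.inr b)

/-- The partition nodes that are children of the cluster node `c`. -/
def children (c : C) : Finset P := Finset.univ.filter fun p => I.tree.partParent p = some c

/-- A feasible solution of the linear program with estimate `α` of the cut demand. The variables are
`x(N, S)`, where `N` is `{p}` or `{p, p'}`; `z(p, s, D, W)`; `y(p, {s, t}, D, W)`, written `yAt`;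
and `y({s, t})`. Only the values at arguments that occur in the constraints are meaningful.
The constraints on a triple `p, s, t` with `𝒮(p, {s, t}) = ∅` are void. -/
structure Solution (α : ℝ) where
  x : Finset P → Finset I.map.DualFace → ℝ
  z : P → I.map.DualFace → Finset I.map.DualFace → Finset I.map.DualFace → ℝ
  yAt : P → Finset I.map.DualFace → Finset I.map.DualFace → Finset I.map.DualFace → ℝ
  y : Finset I.map.DualFace → ℝ
  x_single : ∀ p, ∀ S ∈ I.APlus p, 0 ≤ x {p} S ∧ x {p} S ≤ 1
  x_pair : ∀ p p' q : P, p ≠ p' → I.tree.IsLCA (Sum.inr q) (Sum.inr p) (Sum.inr p') →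
    ∀ S ∈ I.APlusSet {p, p'}, 0 ≤ x {p, p'} S ∧ x {p, p'} S ≤ 1
  x_root : ∅ ∈ I.APlus I.tree.root ∧ x {I.tree.root} ∅ = 1
  assign : ∀ c, (I.children c).Nonempty → ∀ S ∈ I.APlus (I.tree.clusterParent c),
    x {I.tree.clusterParent c} S = ∑ p ∈ I.children c,
      ∑ S' ∈ (I.APlus p).filter (fun S' => S' ∩ I.bdPlus (I.tree.clusterParent c) = S), x {p} S'
  z_eq : ∀ p s, ∀ A ⊆ {s}, ∀ W ∈ I.APlus p,
    z p s A W = ∑ a ∈ I.nodesOf p s,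
      ∑ S ∈ (I.APlus a).filter (fun S => S ∩ {s} = A ∧ S ∩ I.bdPlus p = W), x {a} S
  yAt_eq : ∀ p s t, s ≠ t → ∀ A ⊆ {s, t}, ∀ W ∈ I.APlus p,
    yAt p {s, t} A W = ∑ N ∈ I.pairsOf p s t,
      ∑ S ∈ (I.APlusSet N).filter (fun S => S ∩ {s, t} = A ∧ S ∩ I.bdPlus p = W), x N S
  marginals : ∀ p s t, s ≠ t → (I.pairsOf p s t).Nonempty → ∀ A ⊆ {s}, ∀ W ∈ I.APlus p,
    z p s A W = ∑ A' ∈ ({s, t} : Finset I.map.DualFace).powerset.filter (fun A' => A' ∩ {s} = A),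
      yAt p {s, t} A' W
  y_eq : ∀ s t, s ≠ t →
    y {s, t} = ∑ p : P, ∑ A ∈ ({s, t} : Finset I.map.DualFace).powerset.filter (fun A => A.card = 1),
      ∑ W ∈ I.APlus p, yAt p {s, t} A W
  lift : ∀ p s t, s ≠ t → (I.pairsOf p s t).Nonempty → ∀ W ∈ I.APlus p,
    x {p} W = ∑ N ∈ I.pairsOf p s t,
      ∑ S ∈ (I.APlusSet N).filter (fun S => S ∩ I.bdPlus p = W), x N S
  demand : α ≤ ∑ e ∈ (Finset.univ : Finset I.map.DualFace).powersetCard 2, y e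

/-- A possible outcome of the rounding procedure: `r p = some S` if the partition node `p` is
relevant (it was assigned to its parent cluster node, and so were all partition nodes above it) and
`S ∈ 𝒜⁺(p)` was chosen there; `r p = none` if `p` is not relevant. -/
structure IsRun (r : P → Option (Finset I.map.DualFace)) : Prop where
  root : r I.tree.root = some ∅
  step : ∀ p c S, I.tree.partParent p = some c → r p = some S →
    S ∈ I.APlus p ∧ r (I.tree.clusterParent c) = some (S ∩ I.bdPlus (I.tree.clusterParent c))
  choose : ∀ c, (I.children c).Nonempty → r (I.tree.clusterParent c) ≠ none →
    ∃! p, p ∈ I.children c ∧ r p ≠ none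

namespace Solution

variable {I} {α : ℝ} (L : I.Solution α)

/-- The sum of `x({p}, S)` over the `S ∈ 𝒜⁺(p)` with `S ∩ ∂⁺(q) = W`. -/
def mass (q p : P) (W : Finset I.map.DualFace) : ℝ :=
  ∑ S ∈ (I.APlus p).filter (fun S => S ∩ I.bdPlus q = W), L.x {p} S

/-- The probability with which `p` is assigned to its parent cluster node, where `q` is the parent of
that cluster node and `W` was chosen at `q`. -/
def assignProb (q p : P) (W : Finset I.map.DualFace) : ℝ := 1 / L.x {q} W * L.mass q p W

/-- The probability with which `S` is then chosen at `p`. -/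
def selectProb (q p : P) (W S : Finset I.map.DualFace) : ℝ := L.x {p} S * (L.mass q p W)⁻¹

/-- The probability of the outcome `r`: the product of the probabilities of all random choices made,
one pair of choices for each relevant partition node other than the root. Choices at different
cluster nodes are made independently, given what was chosen above them. -/
def runProb (r : P → Option (Finset I.map.DualFace)) : ℝ :=
  ∏ p : P, match r p, I.tree.partParent p with
    | some S, some c =>
      L.assignProb (I.tree.clusterParent c) p (S ∩ I.bdPlus (I.tree.clusterParent c)) *
        L.selectProb (I.tree.clusterParent c) p (S ∩ I.bdPlus (I.tree.clusterParent c)) S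
    | _, _ => 1

/-- The probability that the outcome of the rounding procedure has the property `X`. -/
def prob (X : (P → Option (Finset I.map.DualFace)) → Prop) : ℝ :=
  ∑ r ∈ Finset.univ.filter (fun r => I.IsRun r ∧ X r), L.runProb r

end Solution

/-- The rounded set `U`: the union of all sets chosen. -/
def rounded (r : P → Option (Finset I.map.DualFace)) : Finset I.map.DualFace :=
  Finset.univ.biUnion fun p => (r p).getD ∅

/-- `|U ∩ {s, t}| = 1` -/
def Separates (s t : I.map.DualFace) (r : P → Option (Finset I.map.DualFace)) : Prop :=
  (I.rounded r ∩ {s, t}).card = 1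

end Setting

end PlanarCut

end

set_option linter.unusedSectionVars false

/-! Well-definedness. The recursive rounding becomes a product measure on tapes, which carry one
independent entry for every cluster node and every set possibly chosen above it. An outcome
prescribed on an ancestor-closed set of partition nodes, with at most one node below each cluster,
is then a cylinder, and its probability is a product of ratios `x(child)/x(parent)`
(`tapeProb_partialRun`). Tapes that encode no run have weight zero, so probabilities of events can
be computed on tapes (`prob_eq_tapeProb`) and the total is 1.

Independence. If `a` and `b` diverge at `p`, the ratios telescope along the two root paths.
Compatible choices `S` at `a` and `S'` at `b` therefore occur together with probability `x(a,S)
x(b,S') / x(p,W)`, where `W` is their common trace at `p` (`prob_pair`).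

Reduction to one node. In every run at most one relevant node separates a given face, and that node
alone decides whether the face is chosen (`eq_of_mem_bd`, `mem_rounded`). Where separating nodes of
`s` and `t` diverge is determined by the faces (`diverge`). The cut event, restricted to runs in
which both faces are separated at or below an admissible divergence node, thus splits disjointly
over that node `p` and the set `W` (`sum_cutAt`).

Comparison with the program. For fixed `p` and `W`, the values `yAt` form a joint law on subsets of
`{s, t}` with total mass `x(p,W)` and marginals `z`, whereas rounding realises the product of the
same marginals. Passing to the product loses at most a factor 2 in the cut probability
(`half_le_cutAt`). Nothing is lost if `p` separates `s` or `t`, because `W` then makes one marginal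
deterministic (`cutAt_eq_of_mem_bd`). Adjacent faces share a dual vertex, which forces this case,
and having two vertices each they are separated in every run (`exists_mem_bd`). This gives equality.
-/

namespace PlanarCut

/-! ### Ancestors and depth in the clustering tree. -/

namespace Clustering

variable {V C P : Type*} (T : Clustering V C P)

/-- The parent cluster of a partition node; by convention, the parent of the root is its only
child, so that `π(p)` is a partition of `K (up p)` for every `p`. -/
noncomputable def up (p : P) : C := (T.partParent p).getD T.root_child.choose

/-- The partition node two levels above `p`; the root is sent to itself. -/
noncomputable def gpar (p : P) : P := T.clusterParent (T.up p)

/-- The ancestor relation (reflexive) on partition nodes. -/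
def Anc (q p : P) : Prop := T.IsAncestor (Sum.inr q) (Sum.inr p)

lemma partParent_root : T.partParent T.root = none := (T.partParent_eq_none _).2 rfl

lemma partParent_eq {p : P} (hp : p ≠ T.root) : T.partParent p = some (T.up p) := by
  cases h : T.partParent p with
  | none => exact absurd ((T.partParent_eq_none p).1 h) hp
  | some c => simp [up, h]

lemma partParent_iff {p : P} {c : C} : T.partParent p = some c ↔ p ≠ T.root ∧ T.up p = c := by
  constructor
  · intro h
    refine ⟨?_, by simp [up, h]⟩
    rintro rfl
    simp [T.partParent_root] at h
  · rintro ⟨hp, rfl⟩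
    exact T.partParent_eq hp

lemma clusterParent_eq_root {c : C} : T.clusterParent c = T.root ↔ c = T.up T.root := by
  have := T.root_child.choose_spec.1 c
  simpa [up, T.partParent_root] using this

lemma gpar_root : T.gpar T.root = T.root := T.clusterParent_eq_root.2 rfl

lemma K_up_root : T.K (T.up T.root) = Set.univ := by
  simpa [up, T.partParent_root] using T.root_child.choose_spec.2

lemma sUnion_parts (p : P) : ⋃₀ T.parts p = T.K (T.up p) := by
  by_cases hp : p = T.root
  · subst hp
    ext v
    simp only [parts, Set.mem_sUnion, Set.mem_ofPred_eq, clusterParent_eq_root]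
    constructor
    · rintro ⟨_, ⟨c, rfl, rfl⟩, h⟩
      exact h
    · exact fun h => ⟨_, ⟨_, rfl, rfl⟩, h⟩
  · rw [← T.cover p _ (T.partParent_eq hp)]
    ext v
    simp [parts]

lemma K_subset {c : C} : T.K c ⊆ T.K (T.up (T.clusterParent c)) := by
  rw [← sUnion_parts]
  exact Set.subset_sUnion_of_mem ⟨c, rfl, rfl⟩

lemma exists_child {p : P} {v : V} (hv : v ∈ T.K (T.up p)) :
    ∃ c, T.clusterParent c = p ∧ v ∈ T.K c := by
  rw [← sUnion_parts] at hv
  obtain ⟨_, ⟨c, hc, rfl⟩, h⟩ := hv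
  exact ⟨c, hc, h⟩

lemma child_unique {c c' : C} {v : V} (h : T.clusterParent c = T.clusterParent c')
    (hv : v ∈ T.K c) (hv' : v ∈ T.K c') : c = c' := by
  by_contra hne
  exact Set.disjoint_left.1 (T.disjoint c c' h hne) hv hv'

lemma anc_refl (p : P) : T.Anc p p := Relation.ReflTransGen.refl

variable {T}

lemma Anc.trans {p q r : P} (h : T.Anc p q) (h' : T.Anc q r) : T.Anc p r :=
  Relation.ReflTransGen.trans h h'

variable (T)

lemma isAncestor_up {p : P} (hp : p ≠ T.root) : T.IsAncestor (Sum.inl (T.up p)) (Sum.inr p) :=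
  Relation.ReflTransGen.single (by simp [parentOf, T.partParent_eq hp])

lemma isAncestor_clusterParent (c : C) :
    T.IsAncestor (Sum.inr (T.clusterParent c)) (Sum.inl c) :=
  Relation.ReflTransGen.single (by simp [parentOf])

lemma anc_gpar (p : P) : T.Anc (T.gpar p) p := by
  by_cases hp : p = T.root
  · rw [hp, gpar_root]
    exact T.anc_refl _
  · exact (T.isAncestor_clusterParent (T.up p)).trans (T.isAncestor_up hp)

lemma anc_cases_tail {q p : P} (h : T.Anc q p) :
    q = p ∨ (p ≠ T.root ∧ T.Anc q (T.gpar p)) := by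
  rcases Relation.ReflTransGen.cases_tail h with h | ⟨c, hc, hcp⟩
  · left
    simpa using h.symm
  · right
    rcases c with c | p'
    · have : p ≠ T.root ∧ T.up p = c := by
        rw [← partParent_iff]
        simpa [parentOf] using hcp
      refine ⟨this.1, ?_⟩
      rcases Relation.ReflTransGen.cases_tail hc with h | ⟨d, hd, hdc⟩
      · simp at h
      · have : d = Sum.inr (T.gpar p) := by
          simpa [parentOf, gpar, this.2] using hdc.symm
        rw [this] at hd
        exact hd
    · simp [parentOf] at hcp

lemma anc_of_isAncestor_cluster {c : C} {p : P} (h : T.IsAncestor (Sum.inl c) (Sum.inr p)) :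
    ∃ p', p' ≠ T.root ∧ T.up p' = c ∧ T.Anc p' p := by
  rcases Relation.ReflTransGen.cases_head h with h | ⟨d, hd, hdp⟩
  · simp at h
  · rcases d with c' | p'
    · simp [parentOf] at hd
    · have : p' ≠ T.root ∧ T.up p' = c := by
        rw [← partParent_iff]
        simpa [parentOf] using hd
      exact ⟨p', this.1, this.2, hdp⟩

lemma anc_cases_head {q p : P} (h : T.Anc q p) :
    q = p ∨ ∃ p', p' ≠ T.root ∧ T.gpar p' = q ∧ T.Anc p' p := by
  rcases Relation.ReflTransGen.cases_head h with h | ⟨c, hc, hcp⟩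
  · left
    simpa using h
  · right
    rcases c with c | p'
    · obtain ⟨p', h1, h2, h3⟩ := T.anc_of_isAncestor_cluster hcp
      refine ⟨p', h1, ?_, h3⟩
      rw [gpar, h2]
      simpa [parentOf] using hc
    · simp [parentOf] at hc

lemma anc_root (p : P) : T.Anc T.root p := T.reachable (Sum.inr p)

/-- Induction on the tree of partition nodes, from an ancestor downwards. -/
lemma anc_induction {q : P} {motive : P → Prop} (base : motive q)
    (step : ∀ p, p ≠ T.root → T.Anc q (T.gpar p) → motive (T.gpar p) → motive p)
    {p : P} (h : T.Anc q p) : motive p := by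
  -- A cluster node inherits the motive of its parent, so induction along tree edges applies to both
  -- kinds of node.
  have key : ∀ a : C ⊕ P, T.IsAncestor (Sum.inr q) a →
      Sum.elim (fun c => T.Anc q (T.clusterParent c) ∧ motive (T.clusterParent c))
        (fun p => T.Anc q p ∧ motive p) a := by
    intro a ha
    induction ha with
    | refl => exact ⟨T.anc_refl q, base⟩
    | @tail b d _ hbd ih =>
      rcases b with c | p' <;> rcases d with c' | p''
      · simp [parentOf] at hbd
      · have : p'' ≠ T.root ∧ T.up p'' = c := by
          rw [← partParent_iff]
          simpa [parentOf] using hbd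
        obtain ⟨h1, rfl⟩ := this
        exact ⟨Anc.trans ih.1 (T.anc_gpar p''), step p'' h1 ih.1 ih.2⟩
      · have : p' = T.clusterParent c' := by simpa [parentOf] using hbd.symm
        subst this
        exact ih
      · simp [parentOf] at hbd
  exact (key _ h).2

lemma induction {motive : P → Prop} (base : motive T.root)
    (step : ∀ p, p ≠ T.root → motive (T.gpar p) → motive p) (p : P) : motive p :=
  T.anc_induction base (fun p hp _ h => step p hp h) (T.anc_root p)

lemma exists_iterate_gpar (p : P) : ∃ n, T.gpar^[n] p = T.root := by
  induction p using T.induction with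
  | base => exact ⟨0, rfl⟩
  | step p hp ih =>
    obtain ⟨n, hn⟩ := ih
    exact ⟨n + 1, hn⟩

/-- The distance from the root, counted in partition nodes. -/
noncomputable def depth (p : P) : ℕ := Nat.find (T.exists_iterate_gpar p)

lemma depth_eq {p : P} (hp : p ≠ T.root) : T.depth p = T.depth (T.gpar p) + 1 :=
  Nat.find_comp_succ _ _ hp

variable {T}

lemma Anc.depth_le {q p : P} (h : T.Anc q p) : T.depth q ≤ T.depth p := by
  refine T.anc_induction (motive := fun p => T.depth q ≤ T.depth p) le_rfl ?_ h
  intro p hp _ ih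
  rw [T.depth_eq hp]
  omega

lemma Anc.eq_of_depth_le {q p : P} (h : T.Anc q p) (h' : T.depth p ≤ T.depth q) : q = p := by
  rcases T.anc_cases_tail h with h | ⟨hp, h⟩
  · exact h
  · have := h.depth_le
    rw [T.depth_eq hp] at h'
    omega

lemma Anc.antisymm {q p : P} (h : T.Anc q p) (h' : T.Anc p q) : q = p :=
  h.eq_of_depth_le h'.depth_le

lemma Anc.total {q q' p : P} (h : T.Anc q p) (h' : T.Anc q' p) : T.Anc q q' ∨ T.Anc q' q := by
  refine T.anc_induction (motive := fun p => T.Anc q' p → T.Anc q q' ∨ T.Anc q' q) Or.inr ?_ h h'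
  intro p hp hq ih h'
  rcases T.anc_cases_tail h' with rfl | ⟨_, h'⟩
  · exact Or.inl (hq.trans (T.anc_gpar _))
  · exact ih h'

lemma Anc.K_subset {q p : P} (h : T.Anc q p) : T.K (T.up p) ⊆ T.K (T.up q) := by
  exact T.anc_induction (motive := fun p => T.K (T.up p) ⊆ T.K (T.up q)) subset_rfl
    (fun p _ _ ih => T.K_subset.trans ih) h

/-! ### Divergence of two root paths. -/

variable (T)

/-- The partition nodes `a` and `b` lie at or below `p`, but not below a common child of `p`. -/
def Diverge (p a b : P) : Prop :=
  T.Anc p a ∧ T.Anc p b ∧ ∀ a' b', a' ≠ T.root → b' ≠ T.root → T.gpar a' = p → T.Anc a' a →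
    T.Anc b' b → T.up a' ≠ T.up b'

variable {T}

/-- Lowest common ancestors compete with cluster nodes too: a child cluster of `p` above both nodes
would be a common ancestor lying strictly below `p`. -/
lemma Diverge.of_isLCA {p a b : P} (h : T.IsLCA (Sum.inr p) (Sum.inr a) (Sum.inr b)) :
    T.Diverge p a b := by
  refine ⟨h.1, h.2.1, fun a' b' ha hb hp haa hbb hab => ?_⟩
  obtain ⟨p', h1, h2, h3⟩ := T.anc_of_isAncestor_cluster
    (h.2.2 (Sum.inl (T.up a')) ((T.isAncestor_up ha).trans haa)
      (hab ▸ (T.isAncestor_up hb).trans hbb))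
  have h4 := h3.depth_le
  rw [T.depth_eq h1, gpar, h2] at h4
  have : T.clusterParent (T.up a') = p := hp
  rw [this] at h4
  omega

lemma Anc.isLCA {p b : P} (h : T.Anc p b) : T.IsLCA (Sum.inr p) (Sum.inr p) (Sum.inr b) :=
  ⟨T.anc_refl p, h, fun _ h' _ => h'⟩

lemma Diverge.anc_of_anc {p a b q : P} (h : T.Diverge p a b) (ha : T.Anc q a) (hb : T.Anc q b) :
    T.Anc q p := by
  rcases ha.total h.1 with h' | h'
  · exact h'
  · rcases T.anc_cases_head h' with rfl | ⟨p', h1, h2, h3⟩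
    · exact h'
    · exact absurd rfl (h.2.2 p' p' h1 h1 h2 (h3.trans ha) (h3.trans hb))

/-- Two ancestors of one node with the same parent cluster coincide. -/
lemma Anc.eq_of_up_eq {q q' p : P} (hq : q ≠ T.root) (hq' : q' ≠ T.root) (h : T.Anc q p)
    (h' : T.Anc q' p) (hu : T.up q = T.up q') : q = q' := by
  have hd : T.depth q = T.depth q' := by rw [T.depth_eq hq, T.depth_eq hq', gpar, gpar, hu]
  rcases h.total h' with h | h
  · exact h.eq_of_depth_le hd.ge
  · exact (h.eq_of_depth_le hd.le).symm

/-- If either node lies above `p`, both are on one root path. Otherwise a common parent cluster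
would bring both paths into the same child of `p`. This makes the union of two diverging paths a
legitimate partial run. -/
lemma Diverge.eq_of_up_eq {p a b q q' : P} (h : T.Diverge p a b) (hq : q ≠ T.root)
    (hq' : q' ≠ T.root) (ha : T.Anc q a) (hb : T.Anc q' b) (hu : T.up q = T.up q') : q = q' := by
  rcases ha.total h.1 with h1 | h1
  · exact (h1.trans h.2.1).eq_of_up_eq hq hq' hb hu
  rcases hb.total h.2.1 with h2 | h2
  · exact ha.eq_of_up_eq hq hq' (h2.trans h.1) hu
  rcases T.anc_cases_tail h1 with rfl | ⟨-, h1'⟩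
  · exact h.2.1.eq_of_up_eq hq hq' hb hu
  rcases T.anc_cases_head h1' with h3 | ⟨p', h3, h4, h5⟩
  · exact absurd hu (h.2.2 q q' hq hq' h3.symm ha hb)
  · have hg : T.gpar q = T.gpar q' := by rw [gpar, gpar, hu]
    exact absurd rfl (h.2.2 p' p' h3 h3 h4 ((h5.trans (T.anc_gpar q)).trans ha)
      (((hg ▸ h5).trans (T.anc_gpar q')).trans hb))

/-! ### The families `π⁺(p)` are partitions. -/

variable (T)

lemma mem_partnPath {q p : P} : q ∈ T.partnPath p ↔ T.Anc q p := Iff.rfl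

lemma partsPlus_root : T.partsPlus T.root = T.parts T.root := by
  ext A
  simp only [partsPlus, Set.mem_union, Set.mem_ofPred_eq, or_iff_left_iff_imp]
  rintro ⟨⟨q, hq, hA⟩, -⟩
  rcases T.anc_cases_tail hq with rfl | ⟨h, -⟩
  · exact hA
  · exact absurd rfl h

lemma K_up_mem_partsPlus (p : P) : T.K (T.up p) ∈ T.partsPlus (T.gpar p) :=
  Or.inl ⟨T.up p, rfl, rfl⟩

lemma mem_partsPlus_of_ne_root {p : P} (hp : p ≠ T.root) {A : Set V} :
    A ∈ T.partsPlus p ↔ A ∈ T.parts p ∨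
      A ∈ T.partsPlus (T.gpar p) ∧ ¬ T.K (T.up p) ⊆ A := by
  simp only [partsPlus, Set.mem_union, Set.mem_ofPred_eq, T.partParent_eq hp, Option.some.injEq,
    forall_eq', mem_partnPath]
  constructor
  · rintro (h | ⟨⟨q, hq, hA⟩, h⟩)
    · exact Or.inl h
    · rcases T.anc_cases_tail hq with rfl | ⟨-, hq⟩
      · exact Or.inl hA
      · refine Or.inr ⟨Or.inr ⟨⟨q, hq, hA⟩, fun c hc hcA => h ?_⟩, h⟩
        obtain ⟨-, rfl⟩ := T.partParent_iff.1 hc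
        exact T.K_subset.trans hcA
  · rintro (h | ⟨h | ⟨⟨q, hq, hA⟩, -⟩, h'⟩)
    · exact Or.inl h
    · exact Or.inr ⟨⟨_, T.anc_gpar p, h⟩, h'⟩
    · exact Or.inr ⟨⟨q, hq.trans (T.anc_gpar p), hA⟩, h'⟩

lemma partsPlus_disjoint (p : P) : ∀ A ∈ T.partsPlus p, ∀ B ∈ T.partsPlus p, ∀ v ∈ A, v ∈ B →
    A = B := by
  have parts_eq : ∀ p, ∀ A ∈ T.parts p, ∀ B ∈ T.parts p, ∀ v ∈ A, v ∈ B → A = B := by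
    rintro p _ ⟨c, rfl, rfl⟩ _ ⟨c', h, rfl⟩ v hv hv'
    rw [T.child_unique h.symm hv hv']
  induction p using T.induction with
  | base =>
    rw [partsPlus_root]
    exact parts_eq _
  | step p hp ih =>
    have mixed : ∀ A ∈ T.parts p, ∀ B ∈ T.partsPlus (T.gpar p), ¬ T.K (T.up p) ⊆ B →
        ∀ v ∈ A, v ∈ B → False := by
      intro A hA B hB hKB v hv hv'
      have : v ∈ T.K (T.up p) := by
        rw [← sUnion_parts]
        exact ⟨A, hA, hv⟩
      exact hKB (ih _ (T.K_up_mem_partsPlus p) _ hB v this hv').subset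
    intro A hA B hB v hv hv'
    rw [T.mem_partsPlus_of_ne_root hp] at hA hB
    rcases hA with hA | ⟨hA, hA'⟩ <;> rcases hB with hB | ⟨hB, hB'⟩
    · exact parts_eq p A hA B hB v hv hv'
    · exact (mixed A hA B hB hB' v hv hv').elim
    · exact (mixed B hB A hA hA' v hv' hv).elim
    · exact ih A hA B hB v hv hv'

lemma sUnion_partsPlus (p : P) : ⋃₀ T.partsPlus p = Set.univ := by
  induction p using T.induction with
  | base => rw [partsPlus_root, sUnion_parts, K_up_root]
  | step p hp ih =>
    rw [Set.eq_univ_iff_forall] at ih ⊢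
    intro v
    obtain ⟨A, hA, hv⟩ := ih v
    by_cases hKA : T.K (T.up p) ⊆ A
    -- Disjointness and a point of the cluster identify the discarded part with the cluster itself,
    -- which its children cover.
    · obtain ⟨w, hw⟩ := T.nonempty (T.up p)
      have := T.partsPlus_disjoint _ _ (T.K_up_mem_partsPlus p) _ hA w hw (hKA hw)
      obtain ⟨c, hc, hvc⟩ := T.exists_child (this ▸ hv)
      exact ⟨_, (T.mem_partsPlus_of_ne_root hp).2 (Or.inl ⟨c, hc, rfl⟩), hvc⟩
    · exact ⟨A, (T.mem_partsPlus_of_ne_root hp).2 (Or.inr ⟨hA, hKA⟩), hv⟩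

end Clustering

end PlanarCut

/-! ### Faces on the boundaries of partitions. -/

namespace PlanarCut

namespace PlanarMap

variable {D : Type*} (M : PlanarMap D)

lemma faceVerts_nonempty (s : M.DualFace) : (M.faceVerts s).Nonempty := by
  obtain ⟨d, hd⟩ := Quotient.exists_rep s
  exact ⟨M.vert d, d, hd, rfl⟩

variable {M}

/-- Dual faces that share a dual edge share a dual vertex. -/
lemma Adjacent.exists_vert {s t : M.DualFace} (h : M.Adjacent s t) :
    ∃ v, v ∈ M.faceVerts s ∧ v ∈ M.faceVerts t := by
  obtain ⟨d, rfl, rfl⟩ := h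
  refine ⟨M.vert d, ⟨d, rfl, rfl⟩, M.rot (M.rev d), ?_, ?_⟩
  · exact Quotient.sound (show M.rot.SameCycle _ _ from
      Equiv.Perm.sameCycle_apply_left.2 (Equiv.Perm.SameCycle.refl _ _))
  · exact Quotient.sound (show (M.rot * M.rev).SameCycle ((M.rot * M.rev) d) _ from
      Equiv.Perm.sameCycle_apply_left.2 (Equiv.Perm.SameCycle.refl _ _))

/-- If the members of `Q` are disjoint, a covered face is on the boundary iff no member of `Q`
contains it. -/
lemma mem_boundary [Finite D] {Q : Set (Set M.DualVertex)}
    (hQ : ∀ A ∈ Q, ∀ B ∈ Q, ∀ v ∈ A, v ∈ B → A = B) {s : M.DualFace} :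
    s ∈ M.boundary Q ↔ M.faceVerts s ⊆ ⋃₀ Q ∧ ∀ A ∈ Q, ¬ M.faceVerts s ⊆ A := by
  simp only [boundary, Finset.mem_filter, Finset.mem_univ, true_and]
  refine and_congr_right fun hs => ⟨?_, fun h => ?_⟩
  · rintro ⟨A, hA, B, hB, hne, ⟨v, hv, hvA⟩, ⟨w, hw, hwB⟩⟩ E hE hsE
    exact hne ((hQ A hA E hE v hvA (hsE hv)).trans (hQ E hE B hB w (hsE hw) hwB))
  · obtain ⟨v, hv⟩ := M.faceVerts_nonempty s
    obtain ⟨A, hA, hvA⟩ := hs hv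
    obtain ⟨w, hw, hwA⟩ := Set.not_subset.1 (h A hA)
    obtain ⟨B, hB, hwB⟩ := hs hw
    exact ⟨A, hA, B, hB, fun h => hwA (h ▸ hwB), ⟨v, hv, hvA⟩, ⟨w, hw, hwB⟩⟩

end PlanarMap

namespace Setting

variable {D C P : Type*} [Finite D] [Fintype C] [Fintype P] (I : Setting D C P)

lemma mem_bd {p : P} {s : I.map.DualFace} :
    s ∈ I.bd p ↔ I.map.faceVerts s ⊆ I.tree.K (I.tree.up p) ∧
      ∀ c, I.tree.clusterParent c = p → ¬ I.map.faceVerts s ⊆ I.tree.K c := by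
  rw [bd, PlanarMap.mem_boundary, Clustering.sUnion_parts]
  · refine and_congr_right fun _ => ⟨fun h c hc => h _ ⟨c, hc, rfl⟩, ?_⟩
    rintro h _ ⟨c, hc, rfl⟩
    exact h c hc
  · rintro _ ⟨c, rfl, rfl⟩ _ ⟨c', h, rfl⟩ v hv hv'
    rw [I.tree.child_unique h.symm hv hv']

lemma mem_bdPlus {p : P} {s : I.map.DualFace} :
    s ∈ I.bdPlus p ↔ ∀ A ∈ I.tree.partsPlus p, ¬ I.map.faceVerts s ⊆ A := by
  rw [bdPlus, PlanarMap.mem_boundary (I.tree.partsPlus_disjoint p), Clustering.sUnion_partsPlus]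
  simp

lemma bdPlus_root : I.bdPlus I.tree.root = ∅ := by
  ext s
  simp only [Finset.notMem_empty, iff_false, mem_bdPlus]
  intro h
  refine h (I.tree.K (I.tree.up I.tree.root)) ?_ (by simp [I.tree.K_up_root])
  rw [I.tree.partsPlus_root]
  exact ⟨_, I.tree.gpar_root, rfl⟩

/-- Only the part `K (up p)` is refined on the way down, so a newly cut face lies inside it and is
cut by `π(p)`. -/
lemma mem_bdPlus_iff {p : P} (hp : p ≠ I.tree.root) {s : I.map.DualFace} :
    s ∈ I.bdPlus p ↔ s ∈ I.bdPlus (I.tree.gpar p) ∨ s ∈ I.bd p := by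
  have hK : ∀ A ∈ I.tree.partsPlus (I.tree.gpar p), I.tree.K (I.tree.up p) ⊆ A →
      A = I.tree.K (I.tree.up p) := by
    intro A hA h
    obtain ⟨v, hv⟩ := I.tree.nonempty (I.tree.up p)
    exact I.tree.partsPlus_disjoint _ A hA _ (I.tree.K_up_mem_partsPlus p) v (h hv) hv
  simp only [mem_bdPlus, I.tree.mem_partsPlus_of_ne_root hp, mem_bd]
  constructor
  · intro h
    by_cases hs : I.map.faceVerts s ⊆ I.tree.K (I.tree.up p)
    · exact Or.inr ⟨hs, fun c hc => h _ (Or.inl ⟨c, hc, rfl⟩)⟩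
    · refine Or.inl fun A hA hsA => ?_
      by_cases hKA : I.tree.K (I.tree.up p) ⊆ A
      · exact hs (hK A hA hKA ▸ hsA)
      · exact h A (Or.inr ⟨hA, hKA⟩) hsA
  · rintro (h | ⟨h, h'⟩) A (hA | ⟨hA, hA'⟩) hsA
    · refine h _ (I.tree.K_up_mem_partsPlus p) (hsA.trans ?_)
      rw [← Clustering.sUnion_parts]
      exact Set.subset_sUnion_of_mem hA
    · exact h A hA hsA
    · obtain ⟨c, hc, rfl⟩ := hA
      exact h' c hc hsA
    · obtain ⟨v, hv⟩ := I.map.faceVerts_nonempty s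
      exact hA' (I.tree.partsPlus_disjoint _ A hA _ (I.tree.K_up_mem_partsPlus p) v (hsA hv)
        (h hv)).superset

lemma bd_root : I.bd I.tree.root = ∅ := by
  ext s
  simp only [Finset.notMem_empty, iff_false, mem_bd]
  rintro ⟨h, h'⟩
  exact h' _ I.tree.gpar_root h

lemma bd_subset_bdPlus (p : P) : I.bd p ⊆ I.bdPlus p := by
  intro s hs
  by_cases hp : p = I.tree.root
  · rw [hp, bd_root] at hs
    simp at hs
  · exact (I.mem_bdPlus_iff hp).2 (Or.inr hs)

lemma bdPlus_gpar_subset (p : P) : I.bdPlus (I.tree.gpar p) ⊆ I.bdPlus p := by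
  by_cases hp : p = I.tree.root
  · rw [hp, Clustering.gpar_root]
  · exact fun s hs => (I.mem_bdPlus_iff hp).2 (Or.inl hs)

lemma bdPlus_mono {q p : P} (h : I.tree.Anc q p) : I.bdPlus q ⊆ I.bdPlus p :=
  I.tree.anc_induction (motive := fun p => I.bdPlus q ⊆ I.bdPlus p) subset_rfl
    (fun p _ _ ih => ih.trans (I.bdPlus_gpar_subset p)) h

/-- The same cycle serves at `q`: it faces fewer amenability conditions there, and `∂⁺` grows
downwards. -/
lemma APlus_inter {q p : P} (h : I.tree.Anc q p) {S : Finset I.map.DualFace}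
    (hS : S ∈ I.APlus p) : S ∩ I.bdPlus q ∈ I.APlus q := by
  simp only [APlus, Finset.mem_filter, Finset.mem_univ, true_and] at hS ⊢
  obtain ⟨E, hE, hE', rfl⟩ := hS
  refine ⟨E, hE, fun q' hq' => hE' q' (Clustering.Anc.trans hq' h), ?_⟩
  rw [Finset.inter_assoc, Finset.inter_eq_right.2 (I.bdPlus_mono h)]

lemma subset_bdPlus {p : P} {S : Finset I.map.DualFace} (hS : S ∈ I.APlus p) : S ⊆ I.bdPlus p := by
  simp only [APlus, Finset.mem_filter, Finset.mem_univ, true_and] at hS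
  obtain ⟨E, -, -, rfl⟩ := hS
  exact Finset.inter_subset_right

lemma eq_empty_of_mem_APlus_root {S : Finset I.map.DualFace} (hS : S ∈ I.APlus I.tree.root) :
    S = ∅ := by
  have := I.subset_bdPlus hS
  rwa [bdPlus_root, Finset.subset_empty] at this

/-- A face on the boundary of `a` lies in one part of the partition of every proper ancestor. -/
lemma eq_of_anc_of_mem_bd {p a : P} (h : I.tree.Anc p a) {s : I.map.DualFace} (hp : s ∈ I.bd p)
    (ha : s ∈ I.bd a) : p = a := by
  rcases I.tree.anc_cases_head h with h | ⟨p', h1, h2, h3⟩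
  · exact h
  · exact absurd ((I.mem_bd.1 ha).1.trans h3.K_subset) ((I.mem_bd.1 hp).2 _ h2)

lemma mem_nodesOf {p a : P} {s : I.map.DualFace} :
    a ∈ I.nodesOf p s ↔ I.tree.Anc p a ∧ s ∈ I.bd a := by
  simp [nodesOf, Clustering.Anc]

lemma exists_diverge {p : P} {s t : I.map.DualFace} (h : (I.pairsOf p s t).Nonempty) :
    ∃ a b, s ∈ I.bd a ∧ t ∈ I.bd b ∧ I.tree.Diverge p a b := by
  obtain ⟨N, hN⟩ := h
  simp only [pairsOf, Finset.mem_filter, Finset.mem_univ, true_and] at hN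
  obtain ⟨a, b, -, ha, hb, h⟩ := hN
  exact ⟨a, b, ha, hb, .of_isLCA h⟩

lemma pairsOf_comm (p : P) (s t : I.map.DualFace) : I.pairsOf p t s = I.pairsOf p s t := by
  ext N
  simp only [pairsOf, Finset.mem_filter, Finset.mem_univ, true_and]
  constructor <;>
  · rintro ⟨a, b, rfl, ha, hb, h1, h2, h3⟩
    exact ⟨b, a, Finset.pair_comm _ _, hb, ha, h2, h1, fun m hb ha => h3 m ha hb⟩

lemma pairsOf_nonempty {p b : P} {s t : I.map.DualFace} (h : I.tree.Anc p b) (hs : s ∈ I.bd p)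
    (ht : t ∈ I.bd b) : (I.pairsOf p s t).Nonempty :=
  ⟨{p, b}, by simpa [pairsOf] using ⟨p, b, rfl, hs, ht, h.isLCA⟩⟩

/-- If one pair of nodes that separate `s` and `t` diverges at `p`, so do all such pairs
below `p`. -/
lemma diverge {p a b : P} {s t : I.map.DualFace} (h : (I.pairsOf p s t).Nonempty)
    (ha : a ∈ I.nodesOf p s) (hb : b ∈ I.nodesOf p t) : I.tree.Diverge p a b := by
  obtain ⟨a₀, b₀, ha₀, hb₀, h₀⟩ := I.exists_diverge h
  rw [mem_nodesOf] at ha hb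
  -- A face lying in one child cluster of `p` lies in no other, so all nodes below `p` that separate
  -- it descend through that child.
  have child : ∀ (u : I.map.DualFace) (a₁ a₂ c : P), u ∈ I.bd a₁ → u ∈ I.bd a₂ →
      I.tree.Anc p a₁ → I.tree.gpar c = p → I.tree.Anc c a₂ →
      ∃ c', c' ≠ I.tree.root ∧ I.tree.gpar c' = p ∧ I.tree.Anc c' a₁ ∧
        I.tree.up c' = I.tree.up c := by
    intro u a₁ a₂ c h1 h2 hp hc hca
    have hu : I.map.faceVerts u ⊆ I.tree.K (I.tree.up c) := (I.mem_bd.1 h2).1.trans hca.K_subset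
    rcases I.tree.anc_cases_head hp with rfl | ⟨c', h3, h4, h5⟩
    · exact absurd hu ((I.mem_bd.1 h1).2 _ hc)
    · refine ⟨c', h3, h4, h5, ?_⟩
      obtain ⟨v, hv⟩ := I.map.faceVerts_nonempty u
      exact I.tree.child_unique (h4.trans hc.symm) (h5.K_subset ((I.mem_bd.1 h1).1 hv)) (hu hv)
  refine ⟨ha.1, hb.1, fun a' b' ha' hb' hp haa hbb hab => ?_⟩
  obtain ⟨c, h1, h2, h3, h4⟩ := child s a₀ a a' ha₀ ha.2 h₀.1 hp haa
  have hp' : I.tree.gpar b' = p := by rw [← hp, Clustering.gpar, Clustering.gpar, hab]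
  obtain ⟨c', h1', -, h3', h4'⟩ := child t b₀ b b' hb₀ hb.2 h₀.2.1 hp' hbb
  exact h₀.2.2 c c' h1 h1' h2 h3 h3' (by rw [h4, h4', hab])

/-- If `s` and `t` have a common vertex, the nodes separating them lie on one path. -/
lemma mem_bd_or_mem_bd {p : P} {s t : I.map.DualFace} {v : I.map.DualVertex}
    (hs : v ∈ I.map.faceVerts s) (ht : v ∈ I.map.faceVerts t) (h : (I.pairsOf p s t).Nonempty) :
    s ∈ I.bd p ∨ t ∈ I.bd p := by
  obtain ⟨a, b, ha, hb, h₀⟩ := I.exists_diverge h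
  rcases I.tree.anc_cases_head h₀.1 with rfl | ⟨a', h1, h2, h3⟩
  · exact Or.inl ha
  rcases I.tree.anc_cases_head h₀.2.1 with rfl | ⟨b', h1', h2', h3'⟩
  · exact Or.inr hb
  refine absurd ?_ (h₀.2.2 a' b' h1 h1' h2 h3 h3')
  exact I.tree.child_unique (h2.trans h2'.symm) (h3.K_subset ((I.mem_bd.1 ha).1 hs))
    (h3'.K_subset ((I.mem_bd.1 hb).1 ht))

lemma mem_children {c : C} {p : P} : p ∈ I.children c ↔ p ≠ I.tree.root ∧ I.tree.up p = c := by
  simp [children, Clustering.partParent_iff]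

/-! ### Consistency of the choices within one run. -/

namespace IsRun

variable {I} {r : P → Option (Finset I.map.DualFace)} (hr : I.IsRun r)
include hr

lemma mem_APlus (h : ∅ ∈ I.APlus I.tree.root) {p : P} {S : Finset I.map.DualFace}
    (hp : r p = some S) : S ∈ I.APlus p := by
  by_cases hroot : p = I.tree.root
  · subst hroot
    obtain rfl : ∅ = S := by simpa [hr.root] using hp
    exact h
  · exact (hr.step p _ S (I.tree.partParent_eq hroot) hp).1

lemma apply_gpar {p : P} {S : Finset I.map.DualFace} (hp : r p = some S) :
    r (I.tree.gpar p) = some (S ∩ I.bdPlus (I.tree.gpar p)) := by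
  by_cases hroot : p = I.tree.root
  · subst hroot
    rw [Clustering.gpar_root, hr.root, bdPlus_root, Finset.inter_empty]
  · exact (hr.step p _ S (I.tree.partParent_eq hroot) hp).2

/-- Each step down only extends the earlier choice to a larger `∂⁺`, so a choice determines those at
all ancestors. -/
lemma apply_anc (h : ∅ ∈ I.APlus I.tree.root) {q p : P} (hq : I.tree.Anc q p)
    {S : Finset I.map.DualFace} (hp : r p = some S) : r q = some (S ∩ I.bdPlus q) := by
  refine I.tree.anc_induction (motive := fun p => ∀ S, r p = some S → r q = some (S ∩ I.bdPlus q))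
    ?_ ?_ hq S hp
  · intro S hS
    rwa [Finset.inter_eq_left.2 (I.subset_bdPlus (hr.mem_APlus h hS))]
  · intro p _ hqp ih S hS
    rw [ih _ (hr.apply_gpar hS), Finset.inter_assoc, Finset.inter_eq_right.2 (I.bdPlus_mono hqp)]

lemma eq_of_up_eq {p p' : P} (hp : p ≠ I.tree.root) (hp' : p' ≠ I.tree.root)
    (h : r p ≠ none) (h' : r p' ≠ none) (hu : I.tree.up p = I.tree.up p') : p = p' := by
  obtain ⟨S, hS⟩ := Option.ne_none_iff_exists'.1 h
  refine (hr.choose (I.tree.up p) ⟨p, I.mem_children.2 ⟨hp, rfl⟩⟩ ?_).unique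
    ⟨I.mem_children.2 ⟨hp, rfl⟩, h⟩ ⟨I.mem_children.2 ⟨hp', hu.symm⟩, h'⟩
  have := hr.apply_gpar hS
  rw [Clustering.gpar] at this
  simp [this]

lemma relevant_gpar {p : P} (h : r p ≠ none) : r (I.tree.gpar p) ≠ none := by
  obtain ⟨S, hS⟩ := Option.ne_none_iff_exists'.1 h
  simp [hr.apply_gpar hS]

lemma relevant_anc {q p : P} (hq : I.tree.Anc q p) (h : r p ≠ none) : r q ≠ none :=
  I.tree.anc_induction (motive := fun p => r p ≠ none → r q ≠ none) id
    (fun _ _ _ ih h => ih (hr.relevant_gpar h)) hq h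

/-- The relevant partition nodes whose clusters contain a given vertex form a chain. -/
lemma chain {v : I.map.DualVertex} {p p' : P} (h : r p ≠ none) (h' : r p' ≠ none)
    (hv : v ∈ I.tree.K (I.tree.up p)) (hv' : v ∈ I.tree.K (I.tree.up p')) :
    I.tree.Anc p p' ∨ I.tree.Anc p' p := by
  induction p using I.tree.induction with
  | base => exact Or.inl (I.tree.anc_root p')
  | step p hp ih =>
    rcases ih (hr.relevant_gpar h) (I.tree.K_subset hv) with h1 | h1
    · rcases I.tree.anc_cases_head h1 with h2 | ⟨p₁, h2, h3, h4⟩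
      · exact Or.inr (h2 ▸ I.tree.anc_gpar p)
      · have hu := I.tree.child_unique h3 (h4.K_subset hv') hv
        obtain rfl := hr.eq_of_up_eq h2 hp (hr.relevant_anc h4 h') h hu
        exact Or.inl h4
    · exact Or.inr (h1.trans (I.tree.anc_gpar p))

lemma eq_of_mem_bd {s : I.map.DualFace} {a b : P} (ha : r a ≠ none) (hb : r b ≠ none)
    (hsa : s ∈ I.bd a) (hsb : s ∈ I.bd b) : a = b := by
  obtain ⟨v, hv⟩ := I.map.faceVerts_nonempty s
  rcases hr.chain ha hb ((I.mem_bd.1 hsa).1 hv) ((I.mem_bd.1 hsb).1 hv) with h | h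
  · exact I.eq_of_anc_of_mem_bd h hsa hsb
  · exact (I.eq_of_anc_of_mem_bd h hsb hsa).symm

/-- Climbing from `q`, the face leaves `∂⁺` at a relevant node that has it in `∂`, and
`eq_of_mem_bd` says that this node is `a`. -/
lemma anc_of_mem_bdPlus {s : I.map.DualFace} {a q : P} (ha : r a ≠ none) (hq : r q ≠ none)
    (hs : s ∈ I.bd a) (hsq : s ∈ I.bdPlus q) : I.tree.Anc a q := by
  induction q using I.tree.induction with
  | base => simp [bdPlus_root] at hsq
  | step q hroot ih =>
    rcases (I.mem_bdPlus_iff hroot).1 hsq with h | h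
    · exact (ih (hr.relevant_gpar hq) h).trans (I.tree.anc_gpar q)
    · exact hr.eq_of_mem_bd ha hq hs h ▸ I.tree.anc_refl a

/-- Whether a face is chosen is decided at the relevant node that first separates it. -/
lemma mem_rounded (h : ∅ ∈ I.APlus I.tree.root) {s : I.map.DualFace} {a : P}
    {S : Finset I.map.DualFace} (ha : r a = some S) (hs : s ∈ I.bd a) :
    s ∈ I.rounded r ↔ s ∈ S := by
  simp only [rounded, Finset.mem_biUnion, Finset.mem_univ, true_and]
  constructor
  · rintro ⟨q, hq⟩
    cases hrq : r q with
    | none => simp [hrq] at hq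
    | some S' =>
      simp only [hrq, Option.getD_some] at hq
      have hanc := hr.anc_of_mem_bdPlus (by simp [ha]) (by simp [hrq]) hs
        (I.subset_bdPlus (hr.mem_APlus h hrq) hq)
      have := hr.apply_anc h hanc hrq
      obtain rfl : S = _ := by simpa [ha] using this
      exact Finset.mem_inter.2 ⟨hq, I.bd_subset_bdPlus a hs⟩
  · exact fun hS => ⟨a, by simpa [ha] using hS⟩

/-- Take the deepest relevant node with a child cluster containing the face. That cluster is no
leaf, since leaves are singletons, and by maximality the partition assigned to it cuts the face. -/
lemma exists_mem_bd {s : I.map.DualFace} (hs : (I.map.faceVerts s).Nontrivial) :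
    ∃ a, r a ≠ none ∧ s ∈ I.bd a := by
  obtain ⟨p, hp, hmax⟩ := Finset.exists_max_image
    (Finset.univ.filter fun p => r p ≠ none ∧
      ∃ c, I.tree.clusterParent c = p ∧ I.map.faceVerts s ⊆ I.tree.K c) I.tree.depth
    ⟨I.tree.root, by
      simpa [hr.root] using ⟨_, I.tree.gpar_root, by simp [I.tree.K_up_root]⟩⟩
  simp only [Finset.mem_filter, Finset.mem_univ, true_and] at hp hmax
  obtain ⟨hrp, c, rfl, hsc⟩ := hp
  have hc : (I.children c).Nonempty := by
    by_contra hne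
    obtain ⟨v, hv⟩ := I.tree.leaf c fun p hp => hne ⟨p, by simpa [children] using hp⟩
    rw [hv] at hsc
    exact Set.not_subsingleton_iff.2 hs (Set.subsingleton_singleton.anti hsc)
  obtain ⟨p, ⟨hpc, hrel⟩, -⟩ := hr.choose c hc hrp
  obtain ⟨hroot, rfl⟩ := I.mem_children.1 hpc
  refine ⟨p, hrel, I.mem_bd.2 ⟨hsc, fun c' hc' hsc' => ?_⟩⟩
  have := hmax p ⟨hrel, c', hc', hsc'⟩
  rw [I.tree.depth_eq hroot, Clustering.gpar] at this
  omega

end IsRun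

end Setting

end PlanarCut

/-! ### Rounding as a product measure on tapes. -/

namespace PlanarCut

/-- In a finite product of probability distributions, the probability of a cylinder is the product
of the probabilities of the prescribed values. -/
lemma sum_prod_cylinder {ι κ : Type*} [Fintype ι] [Fintype κ] (w : ι → κ → ℝ)
    (hw : ∀ i, ∑ k, w i k = 1) (J : Finset ι) (v : ι → κ) (A : Finset (ι → κ))
    (hA : ∀ ω, ω ∈ A ↔ ∀ j ∈ J, ω j = v j) :
    ∑ ω ∈ A, ∏ i, w i (ω i) = ∏ j ∈ J, w j (v j) := by
  have h : A = Fintype.piFinset fun i => if i ∈ J then {v i} else Finset.univ := by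
    ext ω
    rw [hA, Fintype.mem_piFinset]
    refine forall_congr' fun i => ?_
    by_cases hi : i ∈ J <;> simp [hi]
  rw [h, ← Finset.prod_univ_sum, ← Finset.prod_subset (Finset.subset_univ J)]
  · exact Finset.prod_congr rfl fun i hi => by simp [hi]
  · intro i _ hi
    simp [hi, hw]

namespace Setting

variable {D C P : Type*} [Finite D] [Fintype C] [Fintype P] (I : Setting D C P)

/-- A random tape: for each cluster node, and each set that may have been chosen above it, the
child to be assigned to it and the set to be chosen there. -/
abbrev Tape : Type _ := C × Finset I.map.DualFace → Option (P × Finset I.map.DualFace)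

/-- The rounding procedure with tape `ω` chooses the set `S` at the partition node `p`. -/
inductive Chosen (ω : I.Tape) : P → Finset I.map.DualFace → Prop
  | root : Chosen ω I.tree.root ∅
  | step (p : P) (S W : Finset I.map.DualFace) (hp : p ≠ I.tree.root) (hS : S ∈ I.APlus p)
      (hW : S ∩ I.bdPlus (I.tree.gpar p) = W) (h : Chosen ω (I.tree.gpar p) W)
      (hω : ω (I.tree.up p, W) = some (p, S)) : Chosen ω p S

variable {I}

lemma Chosen.of_ne_root {ω : I.Tape} {p : P} {S : Finset I.map.DualFace} (h : I.Chosen ω p S)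
    (hp : p ≠ I.tree.root) : S ∈ I.APlus p ∧
      I.Chosen ω (I.tree.gpar p) (S ∩ I.bdPlus (I.tree.gpar p)) ∧
      ω (I.tree.up p, S ∩ I.bdPlus (I.tree.gpar p)) = some (p, S) := by
  cases h with
  | root => exact absurd rfl hp
  | step _ _ W _ hS hW h hω =>
    subst hW
    exact ⟨hS, h, hω⟩

lemma Chosen.unique {ω : I.Tape} {p : P} {S S' : Finset I.map.DualFace} (h : I.Chosen ω p S)
    (h' : I.Chosen ω p S') : S = S' := by
  induction h generalizing S' with
  | root =>
    cases h' with
    | root => rfl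
    | step _ _ _ hp => exact absurd rfl hp
  | step p S W hp _ _ _ hω ih =>
    cases h' with
    | root => exact absurd rfl hp
    | step _ _ W' _ _ _ h hω' =>
      rw [ih h, hω'] at hω
      simpa using hω.symm

variable (I)

/-- The outcome of the rounding procedure with tape `ω`. -/
noncomputable def decode (ω : I.Tape) (p : P) : Option (Finset I.map.DualFace) :=
  if h : ∃ S, I.Chosen ω p S then some h.choose else none

lemma decode_eq_some {ω : I.Tape} {p : P} {S : Finset I.map.DualFace} :
    I.decode ω p = some S ↔ I.Chosen ω p S := by
  unfold decode
  split_ifs with h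
  · simp only [Option.some.injEq]
    exact ⟨fun h' => h' ▸ h.choose_spec, fun h' => h.choose_spec.unique h'⟩
  · simp only [false_iff]
    exact fun h' => h ⟨S, h'⟩

/-- Prescribed choices `f` on a set `Q` of partition nodes that is closed under taking ancestors
and has at most one node below each cluster node. -/
structure IsPartialRun (Q : Finset P) (f : P → Finset I.map.DualFace) : Prop where
  root : f I.tree.root = ∅
  gpar_mem : ∀ p ∈ Q, I.tree.gpar p ∈ Q
  mem_APlus : ∀ p ∈ Q, f p ∈ I.APlus p
  inter : ∀ p ∈ Q, f p ∩ I.bdPlus (I.tree.gpar p) = f (I.tree.gpar p)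
  eq_of_up_eq : ∀ p ∈ Q, ∀ p' ∈ Q, p ≠ I.tree.root → p' ≠ I.tree.root →
    I.tree.up p = I.tree.up p' → p = p'

variable {I}

/-- The sets above each node of `Q` are prescribed too, so the entries to be read are known in
advance and the event fixes finitely many coordinates. -/
lemma IsPartialRun.decode_iff {Q : Finset P} {f : P → Finset I.map.DualFace}
    (h : I.IsPartialRun Q f) (ω : I.Tape) :
    (∀ p ∈ Q, I.decode ω p = some (f p)) ↔
      ∀ p ∈ Q, p ≠ I.tree.root → ω (I.tree.up p, f (I.tree.gpar p)) = some (p, f p) := by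
  simp only [decode_eq_some]
  constructor
  · intro h' p hp hroot
    rw [← h.inter p hp]
    exact ((h' p hp).of_ne_root hroot).2.2
  · intro h' p
    induction p using I.tree.induction with
    | base =>
      intro _
      rw [h.root]
      exact .root
    | step p hroot ih =>
      intro hp
      exact .step p _ _ hroot (h.mem_APlus p hp) (h.inter p hp) (ih (h.gpar_mem p hp))
        (h' p hp hroot)

namespace Solution

variable {α : ℝ} (L : I.Solution α)

/-- The probability of the entry `o` of the tape at the cluster node `i.1` and the set `i.2`. -/
noncomputable def weight (i : C × Finset I.map.DualFace) :
    Option (P × Finset I.map.DualFace) → ℝ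
  | some u => if u.1 ∈ I.children i.1 ∧ u.2 ∈ I.APlus u.1 ∧
      u.2 ∩ I.bdPlus (I.tree.clusterParent i.1) = i.2 then
      L.x {u.1} u.2 / L.x {I.tree.clusterParent i.1} i.2 else 0
  -- The leftover mass makes the entries sum to one even where the denominator vanishes. Its sign is
  -- never needed.
  | none => 1 - ∑ u : P × Finset I.map.DualFace, if u.1 ∈ I.children i.1 ∧ u.2 ∈ I.APlus u.1 ∧
      u.2 ∩ I.bdPlus (I.tree.clusterParent i.1) = i.2 then
      L.x {u.1} u.2 / L.x {I.tree.clusterParent i.1} i.2 else 0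

lemma sum_weight (i : C × Finset I.map.DualFace) : ∑ o, L.weight i o = 1 := by
  rw [Fintype.sum_option]
  simp [weight]

/-- The constraint `assign` says that the ratios already sum to one, so rounding does not get stuck.
-/
lemma weight_none {c : C} (hc : (I.children c).Nonempty) {W : Finset I.map.DualFace}
    (hW : W ∈ I.APlus (I.tree.clusterParent c)) (hx : L.x {I.tree.clusterParent c} W ≠ 0) :
    L.weight (c, W) none = 0 := by
  have : (∑ u : P × Finset I.map.DualFace, if u.1 ∈ I.children c ∧ u.2 ∈ I.APlus u.1 ∧
      u.2 ∩ I.bdPlus (I.tree.clusterParent c) = W then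
      L.x {u.1} u.2 / L.x {I.tree.clusterParent c} W else 0) = 1 := by
    rw [Fintype.sum_prod_type, ← Finset.sum_subset (Finset.subset_univ (I.children c))]
    · rw [← mul_left_inj' hx, one_mul, Finset.sum_mul]
      refine Eq.trans ?_ (L.assign c hc W hW).symm
      refine Finset.sum_congr rfl fun p hp => ?_
      rw [← Finset.sum_filter, Finset.sum_mul]
      refine Finset.sum_congr ?_ fun _ _ => div_mul_cancel₀ _ hx
      ext S
      simp [hp]
    · intro p _ hp
      simp [hp]
  simp [weight, this]

lemma x_nonneg {p : P} {S : Finset I.map.DualFace} (hS : S ∈ I.APlus p) : 0 ≤ L.x {p} S :=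
  (L.x_single p S hS).1

/-- The left side is one nonnegative term of `assign`. Consequently a zero denominator in a ratio
comes with a zero numerator. -/
lemma x_le_gpar {p : P} {S : Finset I.map.DualFace} (hS : S ∈ I.APlus p) :
    L.x {p} S ≤ L.x {I.tree.gpar p} (S ∩ I.bdPlus (I.tree.gpar p)) := by
  by_cases hp : p = I.tree.root
  · subst hp
    rw [I.eq_empty_of_mem_APlus_root hS, Clustering.gpar_root, Finset.empty_inter]
  have hc : p ∈ I.children (I.tree.up p) := I.mem_children.2 ⟨hp, rfl⟩
  have := L.assign (I.tree.up p) ⟨p, hc⟩ _ (I.APlus_inter (I.tree.anc_gpar p) hS)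
  rw [Clustering.gpar] at this ⊢
  rw [this]
  have h0 : ∀ p' ∈ I.children (I.tree.up p), 0 ≤ ∑ S' ∈ (I.APlus p').filter (fun S' =>
      S' ∩ I.bdPlus (I.tree.clusterParent (I.tree.up p)) =
        S ∩ I.bdPlus (I.tree.clusterParent (I.tree.up p))), L.x {p'} S' := fun p' _ =>
    Finset.sum_nonneg fun S' hS' => L.x_nonneg (Finset.mem_filter.1 hS').1
  refine le_trans ?_ (Finset.single_le_sum h0 hc)
  exact Finset.single_le_sum (f := fun S' => L.x {p} S')
    (fun S' hS' => L.x_nonneg (Finset.mem_filter.1 hS').1) (Finset.mem_filter.2 ⟨hS, rfl⟩)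

lemma x_le_anc {q p : P} (h : I.tree.Anc q p) {S : Finset I.map.DualFace} (hS : S ∈ I.APlus p) :
    L.x {p} S ≤ L.x {q} (S ∩ I.bdPlus q) := by
  refine I.tree.anc_induction (motive := fun p => ∀ S ∈ I.APlus p,
    L.x {p} S ≤ L.x {q} (S ∩ I.bdPlus q)) ?_ ?_ h S hS
  · intro S hS
    rw [Finset.inter_eq_left.2 (I.subset_bdPlus hS)]
  · intro p _ hq ih S hS
    refine (L.x_le_gpar hS).trans ((ih _ (I.APlus_inter (I.tree.anc_gpar p) hS)).trans_eq ?_)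
    rw [Finset.inter_assoc, Finset.inter_eq_right.2 (I.bdPlus_mono hq)]

/-- The factor which the choice of `f p` at `p` contributes to the probability of an outcome. -/
noncomputable def stepProb (f : P → Finset I.map.DualFace) (p : P) : ℝ :=
  if p = I.tree.root then 1 else L.x {p} (f p) / L.x {I.tree.gpar p} (f (I.tree.gpar p))

/-- Distinct non-root nodes of `Q` have distinct parent clusters and so read distinct entries. The
event is therefore a cylinder. -/
lemma tapeProb_partialRun {Q : Finset P} {f : P → Finset I.map.DualFace}
    (h : I.IsPartialRun Q f) (A : Finset I.Tape)
    (hA : ∀ ω, ω ∈ A ↔ ∀ p ∈ Q, I.decode ω p = some (f p)) :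
    ∑ ω ∈ A, ∏ i, L.weight i (ω i) = ∏ p ∈ Q, L.stepProb f p := by
  set Q' := Q.erase I.tree.root with hQ'
  set g : P → C × Finset I.map.DualFace := fun p => (I.tree.up p, f (I.tree.gpar p)) with hg
  have hinj : Set.InjOn g Q' := by
    intro p hp p' hp' hpp
    simp only [hQ', Finset.coe_erase, Set.mem_sdiff, Finset.mem_coe, Set.mem_singleton_iff] at hp hp'
    exact h.eq_of_up_eq p hp.1 p' hp'.1 hp.2 hp'.2 (congrArg Prod.fst hpp)
  have hv : ∃ v : C × Finset I.map.DualFace → Option (P × Finset I.map.DualFace),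
      ∀ p ∈ Q', v (g p) = some (p, f p) := by
    refine ⟨fun i => if hi : ∃ p ∈ Q', g p = i then some (hi.choose, f hi.choose) else none, ?_⟩
    intro p hp
    have hi : ∃ p' ∈ Q', g p' = g p := ⟨p, hp, rfl⟩
    have : hi.choose = p := hinj hi.choose_spec.1 hp hi.choose_spec.2
    simp only [dif_pos hi, this]
  obtain ⟨v, hv⟩ := hv
  have hset : ∀ ω, ω ∈ A ↔ ∀ i ∈ Q'.image g, ω i = v i := by
    intro ω
    simp only [hA, h.decode_iff, Finset.mem_image, forall_exists_index, and_imp,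
      forall_apply_eq_imp_iff₂]
    constructor
    · intro hω p hp
      rw [hv p hp]
      exact hω p (Finset.mem_of_mem_erase hp) (Finset.ne_of_mem_erase hp)
    · intro hω p hp hroot
      have hp' := Finset.mem_erase.2 ⟨hroot, hp⟩
      rw [← hv p hp']
      exact hω p hp'
  rw [sum_prod_cylinder _ L.sum_weight _ v A hset, Finset.prod_image hinj,
    ← Finset.prod_subset (Finset.erase_subset I.tree.root Q)]
  · refine Finset.prod_congr rfl fun p hp => ?_
    have hp₁ := Finset.ne_of_mem_erase hp
    have hp₂ := Finset.mem_of_mem_erase hp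
    rw [hv p hp, stepProb, if_neg hp₁]
    simp only [weight, hg]
    rw [if_pos ⟨I.mem_children.2 ⟨hp₁, rfl⟩, h.mem_APlus p hp₂, h.inter p hp₂⟩]
    rfl
  · intro p hp hp'
    rw [stepProb, if_pos]
    by_contra hne
    exact hp' (Finset.mem_erase.2 ⟨hne, hp⟩)

/-- The choices made in a run form a partial run. -/
lemma isPartialRun (L : I.Solution α) {r : P → Option (Finset I.map.DualFace)} (hr : I.IsRun r) :
    I.IsPartialRun (Finset.univ.filter fun p => r p ≠ none) fun p => (r p).getD ∅ where
  root := by simp [hr.root]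
  gpar_mem p hp := by
    simp only [Finset.mem_filter, Finset.mem_univ, true_and] at hp ⊢
    exact hr.relevant_gpar hp
  mem_APlus p hp := by
    simp only [Finset.mem_filter, Finset.mem_univ, true_and] at hp
    obtain ⟨S, hS⟩ := Option.ne_none_iff_exists'.1 hp
    simpa [hS] using hr.mem_APlus L.x_root.1 hS
  inter p hp := by
    simp only [Finset.mem_filter, Finset.mem_univ, true_and] at hp
    obtain ⟨S, hS⟩ := Option.ne_none_iff_exists'.1 hp
    simp [hS, hr.apply_gpar hS]
  eq_of_up_eq p hp p' hp' := by
    simp only [Finset.mem_filter, Finset.mem_univ, true_and] at hp hp'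
    exact fun h h' => hr.eq_of_up_eq h h' hp hp'

lemma runProb_eq {r : P → Option (Finset I.map.DualFace)} (hr : I.IsRun r) :
    L.runProb r = ∏ p ∈ Finset.univ.filter (fun p => r p ≠ none),
      L.stepProb (fun p => (r p).getD ∅) p := by
  rw [runProb, Finset.prod_filter]
  refine Finset.prod_congr rfl fun p _ => ?_
  cases hp : r p with
  | none => simp
  | some S =>
    by_cases hroot : p = I.tree.root
    · subst hroot
      simp [stepProb, I.tree.partParent_root]
    · have hgp := hr.apply_gpar hp
      have hS := hr.mem_APlus L.x_root.1 hp
      simp only [I.tree.partParent_eq hroot, ne_eq, reduceCtorEq, not_false_eq_true, if_true,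
        stepProb, hroot, if_false, hp, hgp, Option.getD_some]
      simp only [assignProb, selectProb]
      -- The mass cancels between the two random choices; if it is zero, so is its summand `x {p}
      -- S`, and both sides vanish.
      by_cases hm : L.mass (I.tree.gpar p) p (S ∩ I.bdPlus (I.tree.gpar p)) = 0
      · have hx : L.x {p} S = 0 := by
          rw [mass, Finset.sum_eq_zero_iff_of_nonneg fun S' hS' =>
            L.x_nonneg (Finset.mem_filter.1 hS').1] at hm
          exact hm S (Finset.mem_filter.2 ⟨hS, rfl⟩)
        simp [hx]
      · rw [Clustering.gpar] at hm ⊢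
        field_simp

lemma runProb_nonneg {r : P → Option (Finset I.map.DualFace)} (hr : I.IsRun r) :
    0 ≤ L.runProb r := by
  rw [L.runProb_eq hr]
  have h := L.isPartialRun hr
  refine Finset.prod_nonneg fun p hp => ?_
  unfold stepProb
  split_ifs
  · exact zero_le_one
  · exact div_nonneg (L.x_nonneg (h.mem_APlus p hp))
      (L.x_nonneg (h.mem_APlus _ (h.gpar_mem p hp)))

lemma runProb_eq_tapeProb {r : P → Option (Finset I.map.DualFace)} (hr : I.IsRun r) :
    L.runProb r = ∑ ω ∈ Finset.univ.filter (fun ω : I.Tape => I.decode ω = r),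
      ∏ i, L.weight i (ω i) := by
  rw [L.runProb_eq hr, L.tapeProb_partialRun (L.isPartialRun hr)]
  intro ω
  simp only [Finset.mem_filter, Finset.mem_univ, true_and]
  symm
  constructor
  · intro h
    -- Agreement on the relevant nodes suffices: below each relevant parent the single tape entry
    -- already names the relevant child, so no other node is reached.
    have hrel : ∀ p S, I.Chosen ω p S → r p ≠ none := by
      intro p S hS
      induction hS with
      | root => simp [hr.root]
      | step p S W hp hSA hW hch hω ih =>
        have h1 := h _ ih
        rw [I.decode_eq_some] at h1
        obtain ⟨p', ⟨hp', hrp'⟩, -⟩ := hr.choose (I.tree.up p) ⟨p, I.mem_children.2 ⟨hp, rfl⟩⟩ ih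
        obtain ⟨hroot, hup⟩ := I.mem_children.1 hp'
        have h2 := h p' hrp'
        rw [I.decode_eq_some] at h2
        obtain ⟨-, hch', hω'⟩ := h2.of_ne_root hroot
        have hg : I.tree.gpar p' = I.tree.gpar p := by rw [Clustering.gpar, hup, Clustering.gpar]
        rw [hg] at hch' hω'
        rw [hup, hch'.unique hch, hω] at hω'
        simp only [Option.some.injEq, Prod.mk.injEq] at hω'
        rwa [hω'.1]
    ext1 p
    cases hp : r p with
    | none =>
      by_contra hne
      obtain ⟨S, hS⟩ := Option.ne_none_iff_exists'.1 hne
      exact hrel p S (I.decode_eq_some.1 hS) hp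
    | some S =>
      have := h p (by simp [hp])
      simpa [hp] using this
  · rintro rfl p hp
    obtain ⟨S, hS⟩ := Option.ne_none_iff_exists'.1 hp
    simp [hS]

/-- A tape that does not encode a run has probability zero. -/
lemma prod_weight_eq_zero {ω : I.Tape} (h : ¬ I.IsRun (I.decode ω)) :
    ∏ i, L.weight i (ω i) = 0 := by
  by_contra hne
  rw [← ne_eq, Finset.prod_ne_zero_iff] at hne
  simp only [Finset.mem_univ, true_implies] at hne
  have mem_APlus : ∀ {p S}, I.Chosen ω p S → S ∈ I.APlus p := by
    intro p S hS
    cases hS with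
    | root => exact L.x_root.1
    | step _ _ _ _ h => exact h
  -- The weight of an entry that was read has this value as numerator, and no factor of the product
  -- is zero.
  have pos : ∀ {p S}, I.Chosen ω p S → L.x {p} S ≠ 0 := by
    intro p S hS
    cases hS with
    | root => simp [L.x_root.2]
    | step _ _ W hp hSA hW hch hω =>
      intro hx
      refine hne (I.tree.up p, W) ?_
      simp [hω, weight, hx]
  refine h ⟨I.decode_eq_some.2 .root, ?_, ?_⟩
  · intro p c S hc hS
    obtain ⟨hroot, rfl⟩ := I.tree.partParent_iff.1 hc
    rw [I.decode_eq_some] at hS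
    refine ⟨mem_APlus hS, I.decode_eq_some.2 ?_⟩
    cases hS with
    | root => exact absurd rfl hroot
    | step _ _ W hp hSA hW hch hω =>
      subst hW
      exact hch
  · intro c hc hrel
    obtain ⟨W, hW⟩ := Option.ne_none_iff_exists'.1 hrel
    rw [I.decode_eq_some] at hW
    cases hω : ω (c, W) with
    | none => exact absurd (hω ▸ L.weight_none hc (mem_APlus hW) (pos hW)) (hne (c, W))
    | some u =>
      have hu := hne (c, W)
      simp only [hω, weight, ne_eq, ite_eq_right_iff, Classical.not_imp] at hu
      obtain ⟨⟨h1, h2, h3⟩, -⟩ := hu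
      obtain ⟨hroot, rfl⟩ := I.mem_children.1 h1
      refine ⟨u.1, ⟨h1, ?_⟩, ?_⟩
      · rw [I.decode_eq_some.2 (.step u.1 u.2 W hroot h2 h3 hW hω)]
        simp
      · rintro p ⟨hp, hrp⟩
        obtain ⟨hproot, hup⟩ := I.mem_children.1 hp
        obtain ⟨S, hS⟩ := Option.ne_none_iff_exists'.1 hrp
        rw [I.decode_eq_some] at hS
        obtain ⟨-, hch', hω'⟩ := hS.of_ne_root hproot
        have hg : I.tree.gpar p = I.tree.gpar u.1 := by rw [Clustering.gpar, hup, Clustering.gpar]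
        rw [hg] at hch' hω'
        rw [hup, hch'.unique hW, hω] at hω'
        simp only [Option.some.injEq] at hω'
        rw [hω']

lemma prob_eq_tapeProb (X : (P → Option (Finset I.map.DualFace)) → Prop) :
    L.prob X = ∑ ω ∈ Finset.univ.filter (fun ω : I.Tape => X (I.decode ω)),
      ∏ i, L.weight i (ω i) := by
  rw [prob, Finset.sum_congr rfl fun r hr => L.runProb_eq_tapeProb (Finset.mem_filter.1 hr).2.1,
    ← Finset.sum_biUnion]
  · refine Finset.sum_subset ?_ ?_
    · intro ω
      simp only [Finset.mem_biUnion, Finset.mem_filter, Finset.mem_univ, true_and]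
      rintro ⟨_, h, rfl⟩
      exact h.2
    · intro ω h1 h2
      refine L.prod_weight_eq_zero fun hrun => h2 ?_
      simp only [Finset.mem_biUnion, Finset.mem_filter, Finset.mem_univ, true_and] at h1 ⊢
      exact ⟨_, ⟨hrun, h1⟩, rfl⟩
  · intro r _ r' _ hne
    refine Finset.disjoint_left.2 fun ω h h' => hne ?_
    simp only [Finset.mem_filter, Finset.mem_univ, true_and] at h h'
    exact h.symm.trans h'

lemma prob_true : L.prob (fun _ => True) = 1 := by
  rw [L.prob_eq_tapeProb]
  simpa using sum_prod_cylinder _ L.sum_weight ∅ (fun _ => none) Finset.univ (by simp)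

lemma prob_partialRun {Q : Finset P} {f : P → Finset I.map.DualFace} (h : I.IsPartialRun Q f) :
    L.prob (fun r => ∀ p ∈ Q, r p = some (f p)) = ∏ p ∈ Q, L.stepProb f p := by
  rw [L.prob_eq_tapeProb, L.tapeProb_partialRun h]
  simp

end Solution

end Setting

end PlanarCut

/-! ### Probabilities along one and two root paths. -/

namespace PlanarCut

namespace Setting

variable {D C P : Type*} [Finite D] [Fintype C] [Fintype P] {I : Setting D C P}

namespace Solution

variable {α : ℝ} (L : I.Solution α)

lemma prob_mono {X Y : (P → Option (Finset I.map.DualFace)) → Prop}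
    (h : ∀ r, I.IsRun r → X r → Y r) : L.prob X ≤ L.prob Y := by
  refine Finset.sum_le_sum_of_subset_of_nonneg ?_ ?_
  · intro r
    simp only [Finset.mem_filter, Finset.mem_univ, true_and]
    exact fun hr => ⟨hr.1, h r hr.1 hr.2⟩
  · exact fun r hr _ => L.runProb_nonneg (Finset.mem_filter.1 hr).2.1

lemma prob_congr {X Y : (P → Option (Finset I.map.DualFace)) → Prop}
    (h : ∀ r, I.IsRun r → (X r ↔ Y r)) : L.prob X = L.prob Y :=
  le_antisymm (L.prob_mono fun r hr => (h r hr).1) (L.prob_mono fun r hr => (h r hr).2)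

lemma sum_prob {ι : Type*} (T : Finset ι)
    (X : ι → (P → Option (Finset I.map.DualFace)) → Prop)
    (h : ∀ r, I.IsRun r → ∀ i ∈ T, ∀ j ∈ T, X i r → X j r → i = j) :
    ∑ i ∈ T, L.prob (X i) = L.prob fun r => ∃ i ∈ T, X i r := by
  unfold prob
  rw [← Finset.sum_biUnion]
  · refine Finset.sum_congr ?_ fun _ _ => rfl
    ext r
    simp only [Finset.mem_biUnion, Finset.mem_filter, Finset.mem_univ, true_and]
    constructor
    · rintro ⟨i, hi, hr, hX⟩
      exact ⟨hr, i, hi, hX⟩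
    · rintro ⟨hr, i, hi, hX⟩
      exact ⟨i, hi, hr, hX⟩
  · intro i hi j hj hne
    refine Finset.disjoint_left.2 fun r h1 h2 => hne ?_
    simp only [Finset.mem_filter, Finset.mem_univ, true_and] at h1 h2
    exact h r h1.1 i hi j hj h1.2 h2.2

/-- The ratios telescope up to the root, where `x` is 1. -/
lemma prod_stepProb_path (a : P) {S : Finset I.map.DualFace} (hS : S ∈ I.APlus a)
    {f : P → Finset I.map.DualFace} (hf : ∀ q, I.tree.Anc q a → f q = S ∩ I.bdPlus q) :
    ∏ q ∈ Finset.univ.filter (fun q => I.tree.Anc q a), L.stepProb f q = L.x {a} S := by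
  induction a using I.tree.induction generalizing S with
  | base =>
    have : Finset.univ.filter (fun q => I.tree.Anc q I.tree.root) = {I.tree.root} := by
      ext q
      simp only [Finset.mem_filter, Finset.mem_univ, true_and, Finset.mem_singleton]
      exact ⟨fun h => h.antisymm (I.tree.anc_root q), fun h => h ▸ I.tree.anc_refl _⟩
    rw [this, Finset.prod_singleton, stepProb, if_pos rfl, I.eq_empty_of_mem_APlus_root hS,
      L.x_root.2]
  | step p hp ih =>
    have hset : Finset.univ.filter (fun q => I.tree.Anc q p) =
        insert p (Finset.univ.filter fun q => I.tree.Anc q (I.tree.gpar p)) := by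
      ext q
      simp only [Finset.mem_filter, Finset.mem_univ, true_and, Finset.mem_insert]
      constructor
      · intro h
        rcases I.tree.anc_cases_tail h with h | h
        · exact Or.inl h
        · exact Or.inr h.2
      · rintro (rfl | h)
        · exact I.tree.anc_refl _
        · exact h.trans (I.tree.anc_gpar p)
    have hnot : p ∉ Finset.univ.filter fun q => I.tree.Anc q (I.tree.gpar p) := by
      simp only [Finset.mem_filter, Finset.mem_univ, true_and]
      intro h
      have := h.depth_le
      rw [I.tree.depth_eq hp] at this
      omega
    have hg := I.APlus_inter (I.tree.anc_gpar p) hS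
    rw [hset, Finset.prod_insert hnot, ih hg, stepProb, if_neg hp, hf p (I.tree.anc_refl p),
      Finset.inter_eq_left.2 (I.subset_bdPlus hS), hf _ (I.tree.anc_gpar p)]
    · refine div_mul_cancel_of_imp fun h0 => ?_
      exact le_antisymm (h0 ▸ L.x_le_gpar hS) (L.x_nonneg hS)
    · intro q hq
      rw [hf q (hq.trans (I.tree.anc_gpar p)), Finset.inter_assoc,
        Finset.inter_eq_right.2 (I.bdPlus_mono hq)]

/-- The path to `a` contributes `x {a} S`, and the rest of the path to `b`, strictly below `p`,
telescopes to the remaining quotient. -/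
lemma prod_stepProb_two_paths {p a b : P} (hpa : I.tree.Anc p a) (hpb : I.tree.Anc p b)
    (hab : ∀ q, I.tree.Anc q a → I.tree.Anc q b → I.tree.Anc q p)
    {S S' : Finset I.map.DualFace} (hS : S ∈ I.APlus a) (hS' : S' ∈ I.APlus b)
    (hSS : S ∩ I.bdPlus p = S' ∩ I.bdPlus p)
    {f : P → Finset I.map.DualFace} (hf : ∀ q, I.tree.Anc q a → f q = S ∩ I.bdPlus q)
    (hf' : ∀ q, I.tree.Anc q b → f q = S' ∩ I.bdPlus q) :
    ∏ q ∈ Finset.univ.filter (fun q => I.tree.Anc q a ∨ I.tree.Anc q b), L.stepProb f q =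
      L.x {a} S * L.x {b} S' / L.x {p} (S ∩ I.bdPlus p) := by
  refine I.tree.anc_induction (motive := fun b =>
    (∀ q, I.tree.Anc q a → I.tree.Anc q b → I.tree.Anc q p) → ∀ S' ∈ I.APlus b,
    S ∩ I.bdPlus p = S' ∩ I.bdPlus p → (∀ q, I.tree.Anc q b → f q = S' ∩ I.bdPlus q) →
    ∏ q ∈ Finset.univ.filter (fun q => I.tree.Anc q a ∨ I.tree.Anc q b), L.stepProb f q =
      L.x {a} S * L.x {b} S' / L.x {p} (S ∩ I.bdPlus p)) ?_ ?_ hpb hab S' hS' hSS hf'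
  · intro _ S' hS' hSS _
    have hset : Finset.univ.filter (fun q => I.tree.Anc q a ∨ I.tree.Anc q p) =
        Finset.univ.filter fun q => I.tree.Anc q a :=
      Finset.filter_congr fun q _ => or_iff_left_of_imp fun h => h.trans hpa
    rw [hset, L.prod_stepProb_path a hS hf, hSS, Finset.inter_eq_left.2 (I.subset_bdPlus hS'),
      mul_div_cancel_of_imp]
    intro h0
    refine le_antisymm ((L.x_le_anc hpa hS).trans_eq ?_) (L.x_nonneg hS)
    rw [hSS, Finset.inter_eq_left.2 (I.subset_bdPlus hS'), h0]
  · intro b hb hpg ih hab S' hS' hSS hf'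
    have hset : Finset.univ.filter (fun q => I.tree.Anc q a ∨ I.tree.Anc q b) =
        insert b (Finset.univ.filter fun q => I.tree.Anc q a ∨ I.tree.Anc q (I.tree.gpar b)) := by
      ext q
      simp only [Finset.mem_filter, Finset.mem_univ, true_and, Finset.mem_insert]
      constructor
      · rintro (h | h)
        · exact Or.inr (Or.inl h)
        · rcases I.tree.anc_cases_tail h with h | h
          · exact Or.inl h
          · exact Or.inr (Or.inr h.2)
      · rintro (rfl | h | h)
        · exact Or.inr (I.tree.anc_refl _)
        · exact Or.inl h
        · exact Or.inr (h.trans (I.tree.anc_gpar b))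
    have hnot : b ∉ Finset.univ.filter fun q => I.tree.Anc q a ∨ I.tree.Anc q (I.tree.gpar b) := by
      simp only [Finset.mem_filter, Finset.mem_univ, true_and]
      intro h
      have h1 : I.tree.Anc b (I.tree.gpar b) :=
        h.elim (fun h => (hab b h (I.tree.anc_refl b)).trans hpg) id
      have := h1.depth_le
      rw [I.tree.depth_eq hb] at this
      omega
    have hg := I.APlus_inter (I.tree.anc_gpar b) hS'
    rw [hset, Finset.prod_insert hnot, ih (fun q h h' => hab q h (h'.trans (I.tree.anc_gpar b)))
      _ hg, stepProb, if_neg hb, hf' b (I.tree.anc_refl b),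
      Finset.inter_eq_left.2 (I.subset_bdPlus hS'), hf' _ (I.tree.anc_gpar b)]
    · by_cases h0 : L.x {I.tree.gpar b} (S' ∩ I.bdPlus (I.tree.gpar b)) = 0
      · have : L.x {b} S' = 0 := le_antisymm (h0 ▸ L.x_le_gpar hS') (L.x_nonneg hS')
        simp [this]
      · field_simp
    · rw [hSS, Finset.inter_assoc, Finset.inter_eq_right.2 (I.bdPlus_mono hpg)]
    · intro q hq
      rw [hf' q (hq.trans (I.tree.anc_gpar b)), Finset.inter_assoc,
        Finset.inter_eq_right.2 (I.bdPlus_mono hq)]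

/-- Given what is chosen at `p`, the choices at nodes which diverge at `p` are independent. -/
lemma prob_pair {p a b : P} (h : I.tree.Diverge p a b) {S S' : Finset I.map.DualFace}
    (hS : S ∈ I.APlus a) (hS' : S' ∈ I.APlus b) (hSS : S ∩ I.bdPlus p = S' ∩ I.bdPlus p) :
    L.prob (fun r => r a = some S ∧ r b = some S') =
      L.x {a} S * L.x {b} S' / L.x {p} (S ∩ I.bdPlus p) := by
  -- Common ancestors lie above `p`, where the two choices agree, so one prescription `f` fits both
  -- paths.
  have common : ∀ q, I.tree.Anc q a → I.tree.Anc q b → S ∩ I.bdPlus q = S' ∩ I.bdPlus q := by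
    intro q ha hb
    have := I.bdPlus_mono (h.anc_of_anc ha hb)
    rw [← Finset.inter_eq_right.2 this, ← Finset.inter_assoc, ← Finset.inter_assoc, hSS]
  set f : P → Finset I.map.DualFace := fun q =>
    if I.tree.Anc q a then S ∩ I.bdPlus q else S' ∩ I.bdPlus q with hfdef
  have hf : ∀ q, I.tree.Anc q a → f q = S ∩ I.bdPlus q := fun q hq => if_pos hq
  have hf' : ∀ q, I.tree.Anc q b → f q = S' ∩ I.bdPlus q := by
    intro q hq
    by_cases ha : I.tree.Anc q a
    · rw [hf q ha, common q ha hq]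
    · exact if_neg ha
  have hrun : I.IsPartialRun (Finset.univ.filter fun q => I.tree.Anc q a ∨ I.tree.Anc q b) f := by
    refine ⟨?_, ?_, ?_, ?_, ?_⟩
    · rw [hf _ (I.tree.anc_root a), bdPlus_root, Finset.inter_empty]
    · intro q hq
      simp only [Finset.mem_filter, Finset.mem_univ, true_and] at hq ⊢
      exact hq.imp (I.tree.anc_gpar q).trans (I.tree.anc_gpar q).trans
    · intro q hq
      simp only [Finset.mem_filter, Finset.mem_univ, true_and] at hq
      rcases hq with hq | hq
      · exact hf q hq ▸ I.APlus_inter hq hS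
      · exact hf' q hq ▸ I.APlus_inter hq hS'
    · intro q hq
      simp only [Finset.mem_filter, Finset.mem_univ, true_and] at hq
      have hsub := Finset.inter_eq_right.2 (I.bdPlus_gpar_subset q)
      rcases hq with hq | hq
      · rw [hf q hq, hf _ ((I.tree.anc_gpar q).trans hq), Finset.inter_assoc, hsub]
      · rw [hf' q hq, hf' _ ((I.tree.anc_gpar q).trans hq), Finset.inter_assoc, hsub]
    · intro q hq q' hq' hroot hroot' hu
      simp only [Finset.mem_filter, Finset.mem_univ, true_and] at hq hq'
      rcases hq with hq | hq <;> rcases hq' with hq' | hq'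
      · exact hq.eq_of_up_eq hroot hroot' hq' hu
      · exact h.eq_of_up_eq hroot hroot' hq hq' hu
      · exact (h.eq_of_up_eq hroot' hroot hq' hq hu.symm).symm
      · exact hq.eq_of_up_eq hroot hroot' hq' hu
  rw [← L.prod_stepProb_two_paths h.1 h.2.1 (fun q => h.anc_of_anc) hS hS' hSS hf hf',
    ← L.prob_partialRun hrun]
  refine L.prob_congr fun r hr => ?_
  simp only [Finset.mem_filter, Finset.mem_univ, true_and]
  constructor
  · rintro ⟨ha, hb⟩ q (hq | hq)
    · rw [hf q hq, hr.apply_anc L.x_root.1 hq ha]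
    · rw [hf' q hq, hr.apply_anc L.x_root.1 hq hb]
  · intro h'
    have ha := h' a (Or.inl (I.tree.anc_refl a))
    have hb := h' b (Or.inr (I.tree.anc_refl b))
    rw [hf a (I.tree.anc_refl a), Finset.inter_eq_left.2 (I.subset_bdPlus hS)] at ha
    rw [hf' b (I.tree.anc_refl b), Finset.inter_eq_left.2 (I.subset_bdPlus hS')] at hb
    exact ⟨ha, hb⟩

end Solution

end Setting

end PlanarCut

/-! ### Cut probabilities compared with the values of the program. -/

namespace PlanarCut

/-- A sum over all subsets of a pair. -/
lemma sum_powerset_pair {F : Type*} {s t : F} (hst : s ≠ t) (g : Finset F → ℝ) :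
    ∑ A ∈ ({s, t} : Finset F).powerset, g A = g ∅ + g {t} + g {s} + g {s, t} := by
  rw [Finset.sum_powerset_insert (by simpa using hst), ← insert_empty_eq t,
    Finset.sum_powerset_insert (by simp), Finset.sum_powerset_insert (by simp)]
  simp only [Finset.powerset_empty, Finset.sum_singleton, insert_empty_eq]
  ring

lemma card_inter_pair {F : Type*} {s t : F} (hst : s ≠ t) (U : Finset F) :
    (U ∩ {s, t}).card = 1 ↔ (s ∈ U ∧ t ∉ U) ∨ (s ∉ U ∧ t ∈ U) := by
  by_cases hs : s ∈ U <;> by_cases ht : t ∈ U <;>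
    simp [hs, ht, hst, Finset.inter_insert_of_mem, Finset.inter_insert_of_notMem,
      Finset.inter_singleton_of_mem, Finset.inter_singleton_of_notMem]

namespace Setting

variable {D C P : Type*} [Finite D] [Fintype C] [Fintype P] {I : Setting D C P}

lemma APlusSet_singleton (p : P) : I.APlusSet {p} = I.APlus p := by
  ext S
  simp only [APlusSet, Finset.mem_filter, Finset.mem_univ, true_and, Finset.mem_singleton,
    forall_eq, Finset.singleton_biUnion]
  exact ⟨by rintro ⟨f, hf, rfl⟩; exact hf, fun h => ⟨fun _ => S, h, rfl⟩⟩

namespace Solution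

variable {α : ℝ} (L : I.Solution α)

/-- The choices `(a, S)` below `p` that separate `s`, restrict to `A` on `s`, and are compatible
with the choice of `W` at `p`. -/
noncomputable def choices (_ : I.Solution α) (p : P) (s : I.map.DualFace)
    (A W : Finset I.map.DualFace) : Finset (P × Finset I.map.DualFace) :=
  Finset.univ.filter fun u => u.1 ∈ I.nodesOf p s ∧ u.2 ∈ I.APlus u.1 ∧ u.2 ∩ {s} = A ∧
    u.2 ∩ I.bdPlus p = W

lemma mem_choices {p : P} {s : I.map.DualFace} {A W : Finset I.map.DualFace}
    {u : P × Finset I.map.DualFace} : u ∈ L.choices p s A W ↔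
      u.1 ∈ I.nodesOf p s ∧ u.2 ∈ I.APlus u.1 ∧ u.2 ∩ {s} = A ∧ u.2 ∩ I.bdPlus p = W := by
  simp [choices]

lemma z_eq_sum_choices {p : P} {s : I.map.DualFace} {A W : Finset I.map.DualFace} (hA : A ⊆ {s})
    (hW : W ∈ I.APlus p) : L.z p s A W = ∑ u ∈ L.choices p s A W, L.x {u.1} u.2 := by
  rw [L.z_eq p s A hA W hW, choices, Finset.sum_filter, Fintype.sum_prod_type,
    ← Finset.sum_subset (Finset.subset_univ (I.nodesOf p s))]
  · refine Finset.sum_congr rfl fun a ha => ?_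
    rw [← Finset.sum_filter]
    refine Finset.sum_congr ?_ fun _ _ => rfl
    ext S
    simp [ha]
  · intro a _ ha
    simp [ha]

/-- The probability that `W` is chosen at `p` and exactly one of `s`, `t` is chosen, if `p` is the
node at which the nodes that separate `s` and `t` diverge. -/
noncomputable def cutAt (s t : I.map.DualFace) (p : P) (W : Finset I.map.DualFace) : ℝ :=
  (L.z p s {s} W * L.z p t ∅ W + L.z p s ∅ W * L.z p t {t} W) / L.x {p} W

/-- The pairs of choices below `p`, compatible with `W`, that cut exactly one of `s`, `t`. -/
noncomputable def cutChoices (s t : I.map.DualFace) (p : P) (W : Finset I.map.DualFace) :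
    Finset ((P × Finset I.map.DualFace) × (P × Finset I.map.DualFace)) :=
  L.choices p s {s} W ×ˢ L.choices p t ∅ W ∪ L.choices p s ∅ W ×ˢ L.choices p t {t} W

lemma mem_cutChoices {s t : I.map.DualFace} {p : P} {W : Finset I.map.DualFace}
    {i : (P × Finset I.map.DualFace) × (P × Finset I.map.DualFace)} :
    i ∈ L.cutChoices s t p W ↔ (i.1.1 ∈ I.nodesOf p s ∧ i.1.2 ∈ I.APlus i.1.1 ∧
      i.1.2 ∩ I.bdPlus p = W) ∧ (i.2.1 ∈ I.nodesOf p t ∧ i.2.2 ∈ I.APlus i.2.1 ∧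
      i.2.2 ∩ I.bdPlus p = W) ∧ ((s ∈ i.1.2 ∧ t ∉ i.2.2) ∨ (s ∉ i.1.2 ∧ t ∈ i.2.2)) := by
  have h1 : ∀ (S : Finset I.map.DualFace) u, S ∩ {u} = {u} ↔ u ∈ S := by
    intro S u
    by_cases hu : u ∈ S <;> simp [hu]
  have h0 : ∀ (S : Finset I.map.DualFace) u, S ∩ {u} = ∅ ↔ u ∉ S := by
    intro S u
    by_cases hu : u ∈ S <;> simp [hu]
  simp only [cutChoices, Finset.mem_union, Finset.mem_product, mem_choices, h0, h1]
  tauto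

/-- By `prob_pair` every term factors, and the double sums become products of values of `z`. -/
lemma sum_cutChoices {s t : I.map.DualFace} {p : P} {W : Finset I.map.DualFace}
    (h : (I.pairsOf p s t).Nonempty) (hW : W ∈ I.APlus p) :
    ∑ i ∈ L.cutChoices s t p W, L.prob (fun r => r i.1.1 = some i.1.2 ∧ r i.2.1 = some i.2.2) =
      L.cutAt s t p W := by
  have hx : ∀ i ∈ L.cutChoices s t p W,
      L.prob (fun r => r i.1.1 = some i.1.2 ∧ r i.2.1 = some i.2.2) =
        L.x {i.1.1} i.1.2 * L.x {i.2.1} i.2.2 / L.x {p} W := by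
    intro i hi
    obtain ⟨⟨h1, h2, h3⟩, ⟨h4, h5, h6⟩, -⟩ := L.mem_cutChoices.1 hi
    rw [L.prob_pair (I.diverge h h1 h4) h2 h5 (h3.trans h6.symm), h3]
  have hdisj : Disjoint (L.choices p s {s} W ×ˢ L.choices p t ∅ W)
      (L.choices p s ∅ W ×ˢ L.choices p t {t} W) := by
    refine Finset.disjoint_left.2 fun i hi hi' => ?_
    simp only [Finset.mem_product, mem_choices] at hi hi'
    exact Finset.singleton_ne_empty s (hi.1.2.2.1.symm.trans hi'.1.2.2.1)
  rw [Finset.sum_congr rfl hx, cutChoices, Finset.sum_union hdisj, Finset.sum_product,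
    Finset.sum_product, cutAt, L.z_eq_sum_choices subset_rfl hW, L.z_eq_sum_choices subset_rfl hW,
    L.z_eq_sum_choices (Finset.empty_subset _) hW, L.z_eq_sum_choices (Finset.empty_subset _) hW,
    Finset.sum_mul_sum, Finset.sum_mul_sum, add_div, Finset.sum_div, Finset.sum_div]
  simp only [Finset.sum_div]

/-- In the outcome `r`, relevant nodes below `p` separate `s` and `t`, and they diverge at `p`. -/
def SplitAt (s t : I.map.DualFace) (p : P) (r : P → Option (Finset I.map.DualFace)) : Prop :=
  (I.pairsOf p s t).Nonempty ∧ ∃ a ∈ I.nodesOf p s, ∃ b ∈ I.nodesOf p t, r a ≠ none ∧ r b ≠ none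

/-- The summed events are disjoint: a run determines the nodes separating `s` and `t` and the sets
chosen there, and these determine `p` and `W`. Membership in the rounded set is read off at those
nodes. -/
lemma sum_cutAt {s t : I.map.DualFace} (hst : s ≠ t) :
    ∑ p ∈ Finset.univ.filter (fun p => (I.pairsOf p s t).Nonempty), ∑ W ∈ I.APlus p,
      L.cutAt s t p W = L.prob fun r => I.Separates s t r ∧ ∃ p, SplitAt s t p r := by
  have hsum : ∀ p ∈ Finset.univ.filter (fun p => (I.pairsOf p s t).Nonempty),
      ∑ W ∈ I.APlus p, L.cutAt s t p W = ∑ W ∈ I.APlus p, ∑ i ∈ L.cutChoices s t p W,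
        L.prob (fun r => r i.1.1 = some i.1.2 ∧ r i.2.1 = some i.2.2) := by
    intro p hp
    simp only [Finset.mem_filter, Finset.mem_univ, true_and] at hp
    exact Finset.sum_congr rfl fun W hW => (L.sum_cutChoices hp hW).symm
  rw [Finset.sum_congr rfl hsum,
    Finset.sum_congr rfl fun p _ => Finset.sum_sigma' (I.APlus p) (L.cutChoices s t p) _,
    Finset.sum_sigma']
  rw [L.sum_prob _ (fun (i : Σ _ : P, Σ _ : Finset I.map.DualFace,
    (P × Finset I.map.DualFace) × (P × Finset I.map.DualFace)) r =>
      r i.2.2.1.1 = some i.2.2.1.2 ∧ r i.2.2.2.1 = some i.2.2.2.2)]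
  · refine L.prob_congr fun r hr => ?_
    constructor
    · rintro ⟨⟨p, W, ⟨a, S⟩, ⟨b, S'⟩⟩, hi, ha, hb⟩
      simp only [Finset.mem_sigma, Finset.mem_filter, Finset.mem_univ, true_and,
        mem_cutChoices] at hi ha hb
      obtain ⟨hp, hW, ⟨h1, h2, h3⟩, ⟨h4, h5, h6⟩, h7⟩ := hi
      refine ⟨?_, p, hp, a, h1, b, h4, by simp [ha], by simp [hb]⟩
      rw [Separates, card_inter_pair hst, hr.mem_rounded L.x_root.1 ha (I.mem_nodesOf.1 h1).2,
        hr.mem_rounded L.x_root.1 hb (I.mem_nodesOf.1 h4).2]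
      exact h7
    · rintro ⟨hsep, p, hp, a, h1, b, h4, ha, hb⟩
      obtain ⟨S, ha⟩ := Option.ne_none_iff_exists'.1 ha
      obtain ⟨S', hb⟩ := Option.ne_none_iff_exists'.1 hb
      rw [Separates, card_inter_pair hst, hr.mem_rounded L.x_root.1 ha (I.mem_nodesOf.1 h1).2,
        hr.mem_rounded L.x_root.1 hb (I.mem_nodesOf.1 h4).2] at hsep
      have hSA := hr.mem_APlus L.x_root.1 ha
      have hSS : S' ∩ I.bdPlus p = S ∩ I.bdPlus p := by
        have h := hr.apply_anc L.x_root.1 (I.mem_nodesOf.1 h1).1 ha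
        rw [hr.apply_anc L.x_root.1 (I.mem_nodesOf.1 h4).1 hb] at h
        simpa using h
      refine ⟨⟨p, S ∩ I.bdPlus p, (a, S), (b, S')⟩, ?_, ha, hb⟩
      simp only [Finset.mem_sigma, Finset.mem_filter, Finset.mem_univ, true_and, mem_cutChoices]
      exact ⟨hp, I.APlus_inter (I.mem_nodesOf.1 h1).1 hSA, ⟨h1, hSA, trivial⟩,
        ⟨h4, hr.mem_APlus L.x_root.1 hb, hSS⟩, hsep⟩
  · rintro r hr ⟨p, W, ⟨a, S⟩, ⟨b, S'⟩⟩ hi ⟨p₁, W₁, ⟨a₁, S₁⟩, ⟨b₁, S₁'⟩⟩ hi₁ ⟨ha, hb⟩ ⟨ha₁, hb₁⟩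
    simp only [Finset.mem_sigma, Finset.mem_filter, Finset.mem_univ, true_and,
        mem_cutChoices] at hi hi₁ ha hb ha₁ hb₁
    obtain ⟨hp, -, ⟨h1, -, h3⟩, ⟨h4, -, -⟩, -⟩ := hi
    obtain ⟨hp₁, -, ⟨h1', -, h3'⟩, ⟨h4', -, -⟩, -⟩ := hi₁
    obtain rfl := hr.eq_of_mem_bd (by simp [ha]) (by simp [ha₁]) (I.mem_nodesOf.1 h1).2
      (I.mem_nodesOf.1 h1').2
    obtain rfl := hr.eq_of_mem_bd (by simp [hb]) (by simp [hb₁]) (I.mem_nodesOf.1 h4).2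
      (I.mem_nodesOf.1 h4').2
    obtain rfl : S = S₁ := by simpa [ha] using ha₁
    obtain rfl : S' = S₁' := by simpa [hb] using hb₁
    have hd := I.diverge hp h1 h4
    have hd₁ := I.diverge hp₁ h1' h4'
    obtain rfl : p = p₁ :=
      (hd₁.anc_of_anc hd.1 hd.2.1).antisymm (hd.anc_of_anc hd₁.1 hd₁.2.1)
    obtain rfl : W = W₁ := h3.symm.trans h3'
    rfl

lemma yAt_nonneg {s t : I.map.DualFace} (hst : s ≠ t) {p : P} {A W : Finset I.map.DualFace}
    (hA : A ⊆ {s, t}) (hW : W ∈ I.APlus p) : 0 ≤ L.yAt p {s, t} A W := by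
  rw [L.yAt_eq p s t hst A hA W hW]
  refine Finset.sum_nonneg fun N hN => Finset.sum_nonneg fun S hS => ?_
  simp only [pairsOf, Finset.mem_filter, Finset.mem_univ, true_and] at hN
  obtain ⟨a, b, rfl, -, -, h⟩ := hN
  have hS := (Finset.mem_filter.1 hS).1
  by_cases hab : a = b
  · subst hab
    rw [Finset.pair_eq_singleton] at hS ⊢
    rw [APlusSet_singleton] at hS
    exact L.x_nonneg hS
  · exact (L.x_pair a b p hab h S hS).1

lemma x_eq_sum_yAt {s t : I.map.DualFace} (hst : s ≠ t) {p : P} {W : Finset I.map.DualFace}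
    (h : (I.pairsOf p s t).Nonempty) (hW : W ∈ I.APlus p) :
    L.x {p} W = L.yAt p {s, t} ∅ W + L.yAt p {s, t} {t} W + L.yAt p {s, t} {s} W +
      L.yAt p {s, t} {s, t} W := by
  rw [← sum_powerset_pair hst fun A => L.yAt p {s, t} A W, L.lift p s t hst h W hW,
    Finset.sum_congr rfl fun A hA => L.yAt_eq p s t hst A (Finset.mem_powerset.1 hA) W hW,
    Finset.sum_comm]
  refine Finset.sum_congr rfl fun N _ => ?_
  rw [← Finset.sum_fiberwise_of_maps_to (g := fun S => S ∩ {s, t})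
    (t := ({s, t} : Finset I.map.DualFace).powerset)
    fun S _ => Finset.mem_powerset.2 Finset.inter_subset_right]
  refine Finset.sum_congr rfl fun A _ => Finset.sum_congr ?_ fun _ _ => rfl
  ext S
  simp only [Finset.mem_filter]
  tauto

lemma z_eq_yAt {s t : I.map.DualFace} (hst : s ≠ t) {p : P} {W : Finset I.map.DualFace}
    (h : (I.pairsOf p s t).Nonempty) (hW : W ∈ I.APlus p) :
    L.z p s ∅ W = L.yAt p {s, t} ∅ W + L.yAt p {s, t} {t} W ∧
      L.z p s {s} W = L.yAt p {s, t} {s} W + L.yAt p {s, t} {s, t} W := by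
  rw [L.marginals p s t hst h ∅ (Finset.empty_subset _) W hW,
    L.marginals p s t hst h {s} subset_rfl W hW, Finset.sum_filter, Finset.sum_filter,
    sum_powerset_pair hst, sum_powerset_pair hst]
  simp [hst, Finset.inter_singleton_of_mem, Finset.inter_singleton_of_notMem]

/-- Constraints `marginals` and `lift` make `yAt` a joint law with marginals `z` and mass `x {p} W`.
The right side is the cut mass of the product of these marginals. -/
lemma cutAt_eq {s t : I.map.DualFace} (hst : s ≠ t) {p : P} {W : Finset I.map.DualFace}
    (h : (I.pairsOf p s t).Nonempty) (hW : W ∈ I.APlus p) :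
    L.cutAt s t p W =
      ((L.yAt p {s, t} {s} W + L.yAt p {s, t} {s, t} W) *
          (L.yAt p {s, t} ∅ W + L.yAt p {s, t} {s} W) +
        (L.yAt p {s, t} ∅ W + L.yAt p {s, t} {t} W) *
          (L.yAt p {s, t} {t} W + L.yAt p {s, t} {s, t} W)) /
      (L.yAt p {s, t} ∅ W + L.yAt p {s, t} {t} W + L.yAt p {s, t} {s} W +
        L.yAt p {s, t} {s, t} W) := by
  have ht := L.z_eq_yAt hst.symm (I.pairsOf_comm p s t ▸ h) hW
  rw [Finset.pair_comm t s] at ht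
  rw [cutAt, (L.z_eq_yAt hst h hW).1, (L.z_eq_yAt hst h hW).2, ht.1, ht.2,
    L.x_eq_sum_yAt hst h hW]

lemma half_le_cutAt {s t : I.map.DualFace} (hst : s ≠ t) {p : P} {W : Finset I.map.DualFace}
    (h : (I.pairsOf p s t).Nonempty) (hW : W ∈ I.APlus p) :
    1 / 2 * (L.yAt p {s, t} {s} W + L.yAt p {s, t} {t} W) ≤ L.cutAt s t p W := by
  rw [L.cutAt_eq hst h hW]
  have he := L.yAt_nonneg hst (Finset.empty_subset _) hW
  have ha := L.yAt_nonneg (A := {s}) hst (by simp) hW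
  have hb := L.yAt_nonneg (A := {t}) hst (by simp) hW
  have hg := L.yAt_nonneg (A := {s, t}) hst subset_rfl hW
  generalize L.yAt p {s, t} ∅ W = e at *
  generalize L.yAt p {s, t} {s} W = a at *
  generalize L.yAt p {s, t} {t} W = b at *
  generalize L.yAt p {s, t} {s, t} W = g at *
  rcases (by positivity : 0 ≤ e + b + a + g).eq_or_lt with h0 | h0
  · rw [← h0, div_zero]
    linarith
  · rw [le_div_iff₀ h0]
    -- Twice the difference of the two sides is `(a - b)² + (a + b)(e + g) + 4eg`.
    nlinarith [sq_nonneg (a - b), mul_nonneg he ha, mul_nonneg he hb, mul_nonneg he hg,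
      mul_nonneg ha hg, mul_nonneg hb hg]

/-- A choice that contradicts the choice of `W` at `p` has no weight. -/
lemma yAt_eq_zero {s t u : I.map.DualFace} (hst : s ≠ t) {p : P} {A W : Finset I.map.DualFace}
    (hA : A ⊆ {s, t}) (hW : W ∈ I.APlus p) (hu : u ∈ I.bd p) (hut : u = s ∨ u = t)
    (h : ¬ (u ∈ A ↔ u ∈ W)) : L.yAt p {s, t} A W = 0 := by
  rw [L.yAt_eq p s t hst A hA W hW]
  refine Finset.sum_eq_zero fun N _ => ?_
  rw [Finset.filter_false_of_mem, Finset.sum_empty]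
  rintro S - ⟨rfl, rfl⟩
  exact h (by simp [I.bd_subset_bdPlus p hu, hut])

/-- The set `W` already decides the face separated at `p`, so two of the four joint values vanish,
and a joint law with a deterministic marginal is a product. -/
lemma cutAt_eq_of_mem_bd {s t : I.map.DualFace} (hst : s ≠ t) {p : P}
    {W : Finset I.map.DualFace} (h : (I.pairsOf p s t).Nonempty) (hW : W ∈ I.APlus p)
    (hp : s ∈ I.bd p ∨ t ∈ I.bd p) :
    L.cutAt s t p W = L.yAt p {s, t} {s} W + L.yAt p {s, t} {t} W := by
  rw [L.cutAt_eq hst h hW]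
  have he := L.yAt_nonneg hst (Finset.empty_subset _) hW
  have ha := L.yAt_nonneg (A := {s}) hst (by simp) hW
  have hb := L.yAt_nonneg (A := {t}) hst (by simp) hW
  have hg := L.yAt_nonneg (A := {s, t}) hst subset_rfl hW
  have cancel : ∀ u v : ℝ, 0 ≤ u → 0 ≤ v → u * (u + v) / (u + v) = u := by
    intro u v hu hv
    exact mul_div_cancel_of_imp fun h0 => by linarith
  rcases hp with hp | hp
  · by_cases hs : s ∈ W
    · rw [L.yAt_eq_zero hst (Finset.empty_subset _) hW hp (Or.inl rfl) (by simp [hs]),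
        L.yAt_eq_zero (A := {t}) hst (by simp) hW hp (Or.inl rfl) (by simp [hs, hst])]
      simpa [mul_comm] using cancel _ _ ha hg
    · rw [L.yAt_eq_zero (A := {s}) hst (by simp) hW hp (Or.inl rfl) (by simp [hs]),
        L.yAt_eq_zero (A := {s, t}) hst subset_rfl hW hp (Or.inl rfl) (by simp [hs])]
      simpa [mul_comm, add_comm] using cancel _ _ hb he
  · by_cases ht : t ∈ W
    · rw [L.yAt_eq_zero hst (Finset.empty_subset _) hW hp (Or.inr rfl) (by simp [ht]),
        L.yAt_eq_zero (A := {s}) hst (by simp) hW hp (Or.inr rfl) (by simp [ht, hst.symm])]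
      simpa [mul_comm] using cancel _ _ hb hg
    · rw [L.yAt_eq_zero (A := {t}) hst (by simp) hW hp (Or.inr rfl) (by simp [ht]),
        L.yAt_eq_zero (A := {s, t}) hst subset_rfl hW hp (Or.inr rfl) (by simp [ht])]
      simpa [mul_comm, add_comm] using cancel _ _ ha he

lemma y_eq_sum {s t : I.map.DualFace} (hst : s ≠ t) :
    L.y {s, t} = ∑ p ∈ Finset.univ.filter (fun p => (I.pairsOf p s t).Nonempty),
      ∑ W ∈ I.APlus p, (L.yAt p {s, t} {s} W + L.yAt p {s, t} {t} W) := by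
  rw [L.y_eq s t hst, Finset.sum_filter]
  refine Finset.sum_congr rfl fun p _ => ?_
  rw [Finset.sum_filter, sum_powerset_pair hst]
  simp only [Finset.card_empty, zero_ne_one, if_false, Finset.card_singleton, if_true,
    Finset.card_pair hst, OfNat.ofNat_ne_one, zero_add, add_zero]
  split_ifs with h
  · rw [← Finset.sum_add_distrib]
    exact Finset.sum_congr rfl fun W _ => add_comm _ _
  · rw [Finset.not_nonempty_iff_eq_empty] at h
    have h0 : ∀ A ⊆ {s, t}, ∀ W ∈ I.APlus p, L.yAt p {s, t} A W = 0 := by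
      intro A hA W hW
      rw [L.yAt_eq p s t hst A hA W hW, h, Finset.sum_empty]
    rw [Finset.sum_eq_zero (h0 {s} (by simp)), Finset.sum_eq_zero (h0 {t} (by simp)), add_zero]

/-- Runs without a split of `s` and `t` are discarded, which only lowers the probability. -/
lemma half_y_le_prob {s t : I.map.DualFace} (hst : s ≠ t) :
    1 / 2 * L.y {s, t} ≤ L.prob (I.Separates s t) := by
  refine le_trans ?_ (L.prob_mono (X := fun r => I.Separates s t r ∧ ∃ p, SplitAt s t p r)
    fun _ _ h => h.1)
  rw [← L.sum_cutAt hst, L.y_eq_sum hst, Finset.mul_sum]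
  refine Finset.sum_le_sum fun p hp => ?_
  rw [Finset.mul_sum]
  exact Finset.sum_le_sum fun W hW => L.half_le_cutAt hst (Finset.mem_filter.1 hp).2 hW

/-- In every run both faces are separated, and the common vertex puts the two nodes on one chain, so
the upper one is the divergence node. No run is discarded and every local comparison is exact. -/
lemma prob_eq_y {s t : I.map.DualFace} (hst : s ≠ t) (hadj : I.map.Adjacent s t)
    (hs : (I.map.faceVerts s).Nontrivial) (ht : (I.map.faceVerts t).Nontrivial) :
    L.prob (I.Separates s t) = L.y {s, t} := by
  obtain ⟨v, hvs, hvt⟩ := hadj.exists_vert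
  have hcover : L.prob (I.Separates s t) =
      L.prob fun r => I.Separates s t r ∧ ∃ p, SplitAt s t p r := by
    refine L.prob_congr fun r hr => (and_iff_left ?_).symm
    obtain ⟨a, hra, ha⟩ := hr.exists_mem_bd hs
    obtain ⟨b, hrb, hb⟩ := hr.exists_mem_bd ht
    rcases hr.chain hra hrb ((I.mem_bd.1 ha).1 hvs) ((I.mem_bd.1 hb).1 hvt) with h | h
    · exact ⟨a, I.pairsOf_nonempty h ha hb, a, I.mem_nodesOf.2 ⟨I.tree.anc_refl a, ha⟩, b,
        I.mem_nodesOf.2 ⟨h, hb⟩, hra, hrb⟩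
    · exact ⟨b, I.pairsOf_comm b s t ▸ I.pairsOf_nonempty h hb ha, a, I.mem_nodesOf.2 ⟨h, ha⟩, b,
        I.mem_nodesOf.2 ⟨I.tree.anc_refl b, hb⟩, hra, hrb⟩
  rw [hcover, ← L.sum_cutAt hst, L.y_eq_sum hst]
  refine Finset.sum_congr rfl fun p hp => Finset.sum_congr rfl fun W hW => ?_
  have hp := (Finset.mem_filter.1 hp).2
  exact L.cutAt_eq_of_mem_bd hst hp hW (I.mem_bd_or_mem_bd hvs hvt hp)

end Solution

end Setting

end PlanarCut

theorem mainTheorem2 {D C P : Type*} [Finite D] [Fintype C] [Fintype P]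
    (I : PlanarCut.Setting D C P) (demands : Set (Finset I.map.DualFace))
    (hdemands : ∀ e ∈ demands, e.card = 2) (α : ℝ) (L : I.Solution α) :
    ((∀ r, I.IsRun r → 0 ≤ L.runProb r) ∧ L.prob (fun _ => True) = 1) ∧
    (∀ s t, s ≠ t → I.map.Adjacent s t →
      (I.map.faceVerts s).Nontrivial → (I.map.faceVerts t).Nontrivial →
      L.prob (I.Separates s t) = L.y {s, t}) ∧
    (∀ s t, {s, t} ∈ demands →
      L.prob (I.Separates s t) ≥ 1 / 2 * L.y {s, t}) := by
  refine ⟨⟨fun _ => L.runProb_nonneg, L.prob_true⟩, fun _ _ => L.prob_eq_y, fun s t h => ?_⟩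
  refine L.half_y_le_prob ?_
  rintro rfl
  simpa using hdemands _ h
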